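/- Work in units with $\hbar=1$. Consider the state $|\varphi_e(0)\rangle=\frac{1}{\sqrt{15}}\bigl[\sqrt7\,|0\rangle+\sqrt2\,(|{-1}\rangle+|1\rangle+|{-\tfrac{11}{5}}\rangle+|\tfrac{11}{5}\rangle)\bigr]$, where $|E\rangle$ denotes the normalised eigenvector with eigenvalue $E$ of the Hamiltonian $H_e=\sum_{E\in\{0,\pm1,\pm11/5\}}E\,|E\rangle\langle E|$, let $|\varphi_e(\tau)\rangle=e^{-iH_e\tau}|\varphi_e(0)\rangle$, and let $\sqrt F(\tau)=|\langle\varphi_e(0)|\varphi_e(\tau)\rangle|$ be the root fidelity. Let $\tau_{c1}$ be the first time $\tau\ge0$ at which $\sqrt F(\tau)=0$, and let $\tau_{c2}$ be the local minimum point of $\sqrt F$ with $|\tau_{c2}-4.110|\le 0.0005$ which is also the first time $\tau\ge0$ at which $\sqrt F$ takes the value $\sqrt F(\tau_{c2})$. Both times exist and are unique, $|\tau_{c1}-9.693|\le0.0005$, and $|\sqrt F(\tau_{c2})-0.0682|\le 0.00005$. There is a unique real polynomial $p_e$ of degree at most $34$ with $p_e^{(j)}(0)=\cos^{(j)}(0)$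 for $0\le j\le 2$, $p_e^{(j)}(\pm\tau_{c1})=\cos^{(j)}(\pm\tau_{c1})$ for $0\le j\le 3$, $p_e^{(j)}(\pm\tau_{c2})=\cos^{(j)}(\pm\tau_{c2})$ for $0\le j\le 1$, $p_e^{(j)}(\pm\tfrac{11}{5}\tau_{c1})=\cos^{(j)}(\pm\tfrac{11}{5}\tau_{c1})$ for $0\le j\le 5$, and $p_e^{(j)}(\pm\tfrac{11}{5}\tau_{c2})=\cos^{(j)}(\pm\tfrac{11}{5}\tau_{c2})$ for $0\le j\le 3$. This polynomial is even and of degree exactly $34$, it satisfies $p_e(x)\le\cos x$ for all real $x$, and $p_e(x)=\cos x$ holds if and only if $x\in\{0,\pm\tau_{c1},\pm\tau_{c2},\pm\tfrac{11}{5}\tau_{c1},\pm\tfrac{11}{5}\tau_{c2}\}$. -/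

import Mathlib

open Polynomial

noncomputable section

/-- The energy levels `0, ±1, ±11/5`, in units with `ħ = 1`. -/
def energy : Fin 5 → ℝ := ![0, -1, 1, -(11 / 5), 11 / 5]

/-- The Hamiltonian, written in its orthonormal energy eigenbasis. -/
def hamiltonian : Matrix (Fin 5) (Fin 5) ℂ :=
  Matrix.diagonal fun k => (energy k : ℂ)

/-- The initial state
`(√7 |0⟩ + √2 (|-1⟩ + |1⟩ + |-11/5⟩ + |11/5⟩)) / √15` in the energy eigenbasis. -/
def initialState : EuclideanSpace ℂ (Fin 5) :=
  WithLp.toLp 2 fun k => (((![√7, √2, √2, √2, √2] : Fin 5 → ℝ) k / √15 : ℝ) : ℂ)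

/-- The state at time `τ`, namely `exp (-i H τ)` applied to the initial state. -/
def evolvedState (τ : ℝ) : EuclideanSpace ℂ (Fin 5) :=
  WithLp.toLp 2
    ((NormedSpace.exp ((-(Complex.I * (τ : ℂ))) • hamiltonian)).mulVec
      (WithLp.ofLp initialState))

/-- The root fidelity `√F = |⟨φ(0)|φ(τ)⟩|` between the initial state and the state at time `τ`. -/
def rootFidelity (τ : ℝ) : ℝ :=
  ‖inner ℂ initialState (evolvedState τ)‖

/-- `τ` is the first nonnegative time at which the root fidelity takes the value `f`. -/
def IsFirstTime (f τ : ℝ) : Prop :=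
  IsLeast {t : ℝ | 0 ≤ t ∧ rootFidelity t = f} τ

/-- `τ_c1`: the first time at which the root fidelity vanishes. -/
def IsTauC1 (τ : ℝ) : Prop := IsFirstTime 0 τ

/-- `τ_c2`: the local minimum point of the root fidelity with `τ ≈ 4.110`, which moreover is the
first time at which the root fidelity takes its (local minimum) value. -/
def IsTauC2 (τ : ℝ) : Prop :=
  |τ - 4.110| ≤ 0.0005 ∧ IsLocalMin rootFidelity τ ∧ IsFirstTime (rootFidelity τ) τ

/-- The polynomial `p` and the function `f` have the same derivatives of order `0, …, m - 1`
at `x`. -/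
def AgreesToOrder (f : ℝ → ℝ) (p : ℝ[X]) (x : ℝ) (m : ℕ) : Prop :=
  ∀ j < m, (derivative^[j] p).eval x = iteratedDeriv j f x

/-- `p` is the Hermite interpolating polynomial `p_e` of `cos`. There are
`3 + 2 * (4 + 2 + 6 + 4) = 35` interpolation conditions, hence the degree bound `34`. -/
def IsHermitePe (τ₁ τ₂ : ℝ) (p : ℝ[X]) : Prop :=
  p.natDegree ≤ 34 ∧
  AgreesToOrder Real.cos p 0 3 ∧
  (AgreesToOrder Real.cos p τ₁ 4 ∧ AgreesToOrder Real.cos p (-τ₁) 4) ∧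
  (AgreesToOrder Real.cos p τ₂ 2 ∧ AgreesToOrder Real.cos p (-τ₂) 2) ∧
  (AgreesToOrder Real.cos p (11 * τ₁ / 5) 6 ∧ AgreesToOrder Real.cos p (-(11 * τ₁ / 5)) 6) ∧
  (AgreesToOrder Real.cos p (11 * τ₂ / 5) 4 ∧ AgreesToOrder Real.cos p (-(11 * τ₂ / 5)) 4)

/-- The set of interpolation nodes. -/
def nodeSet (τ₁ τ₂ : ℝ) : Set ℝ :=
  {0, τ₁, -τ₁, τ₂, -τ₂, 11 * τ₁ / 5, -(11 * τ₁ / 5), 11 * τ₂ / 5, -(11 * τ₂ / 5)}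

end

/-! Put y = x². The function cos √y is entire in y, and an even polynomial p(x) = P(x²) solves the
Hermite problem as soon as P, of degree at most 17, interpolates cos √y at the squared nodes with
multiplicities 2, 4, 2, 6, 4 (18 in all). Uniqueness for the 35 conditions in x forces p_e to be
this polynomial. All squared multiplicities are even, so the nodal polynomial ω is nonnegative and
positive off the nodes, and it remains to show that cos √y − P(y) has the sign of ω on y ≥ 0
(`IsCosSqrtInterpolant.eval_lt`).

The usual error formula would need the 18th derivative of cos √y, which is `cosSqrt 18`, to be
positive on the whole half-line; it is only shown positive on [0, 455], an interval containing the
nodes. Suppose cos √y ≤ P(y) at a non-node y and choose κ ≤ 0 so that E = cos √y − P − κω also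
vanishes at y. With its 19 zeros, Rolle gives E⁽¹⁷⁾ two zeros in [0, ∞). Beyond 455, E⁽¹⁷⁾ > 0: the
mean of the nodes is at most 225, so a Jensen argument makes the leading coefficient of P at most
−`cosSqrt 17 225` / 17!, and this outweighs the tail of `cosSqrt 17`. Hence both zeros lie in [0,
455], where E⁽¹⁸⁾ > 0, a contradiction.

The bounds on `cosSqrt m` come from a Bessel-type three-term recurrence and a decreasing energy. The
two times are located by elementary estimates of the real overlap 7 + 4 cos τ + 4 cos(11τ/5). -/

open scoped Nat

/-! ### Derivatives of cos √y: recurrence, energy and positivity -/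

/-- The absolute value of the coefficient of `y ^ k` in the `m`-th derivative of `cos √y`. -/
noncomputable def cosSqrtCoeff (m k : ℕ) : ℝ := ((k + m)! : ℝ) / ((k ! : ℝ) * ((2 * k + 2 * m)! : ℝ))

/-- `(-1) ^ m` times the `m`-th derivative of the entire function `cos √y`. -/
noncomputable def cosSqrt (m : ℕ) (y : ℝ) : ℝ := ∑' k : ℕ, (-1) ^ k * cosSqrtCoeff m k * y ^ k

lemma cosSqrtCoeff_nonneg (m k : ℕ) : 0 ≤ cosSqrtCoeff m k := by
  unfold cosSqrtCoeff; positivity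

lemma cosSqrtCoeff_le (m k : ℕ) : cosSqrtCoeff m k ≤ 1 / (k ! : ℝ) := by
  unfold cosSqrtCoeff
  have h : ((k + m)! : ℝ) ≤ ((2 * k + 2 * m)! : ℝ) := by
    exact_mod_cast Nat.factorial_le (by omega)
  rw [div_le_div_iff₀ (by positivity) (by positivity)]
  nlinarith [(by positivity : (0 : ℝ) < (k ! : ℝ))]

lemma succ_mul_cosSqrtCoeff_succ (m k : ℕ) :
    ((k : ℝ) + 1) * cosSqrtCoeff m (k + 1) = cosSqrtCoeff (m + 1) k := by
  unfold cosSqrtCoeff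
  rw [show k + 1 + m = k + (m + 1) by ring, show 2 * (k + 1) + 2 * m = 2 * k + 2 * (m + 1) by ring,
    Nat.factorial_succ k]
  push_cast
  field_simp

lemma cosSqrtCoeff_eq (m k : ℕ) :
    cosSqrtCoeff m k = (4 * m + 2 + 4 * k) * cosSqrtCoeff (m + 1) k := by
  unfold cosSqrtCoeff
  rw [show k + (m + 1) = (k + m) + 1 by ring,
    show 2 * k + 2 * (m + 1) = (2 * k + 2 * m) + 1 + 1 by ring,
    Nat.factorial_succ (k + m), Nat.factorial_succ (2 * k + 2 * m + 1),
    Nat.factorial_succ (2 * k + 2 * m)]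
  push_cast
  field_simp
  ring

lemma summable_cosSqrt (m : ℕ) (y : ℝ) :
    Summable fun k : ℕ => (-1) ^ k * cosSqrtCoeff m k * y ^ k := by
  refine Summable.of_norm_bounded (Real.summable_pow_div_factorial |y|) fun k => ?_
  rw [norm_mul, norm_mul, norm_pow, norm_neg, norm_one, one_pow, one_mul, norm_pow,
    Real.norm_eq_abs, Real.norm_eq_abs, abs_of_nonneg (cosSqrtCoeff_nonneg m k)]
  calc cosSqrtCoeff m k * |y| ^ k ≤ 1 / (k ! : ℝ) * |y| ^ k := by
        gcongr; exact cosSqrtCoeff_le m k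
    _ = |y| ^ k / k ! := by ring

lemma hasDerivAt_cosSqrt (m : ℕ) (y : ℝ) : HasDerivAt (cosSqrt m) (-cosSqrt (m + 1) y) y := by
  set R : ℝ := |y| + 1
  have hR : 0 ≤ R := by positivity
  -- Truncated subtraction makes the majorant 1 at k = 0, where the differentiated term is 0.
  have hu : Summable fun k : ℕ => R ^ (k - 1) / ((k - 1)! : ℝ) := by
    rw [← summable_nat_add_iff 1]
    simpa using Real.summable_pow_div_factorial R
  have key := hasDerivAt_tsum_of_isPreconnected
    (g := fun (k : ℕ) (x : ℝ) => (-1) ^ k * cosSqrtCoeff m k * x ^ k)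
    (g' := fun (k : ℕ) (x : ℝ) => (-1) ^ k * cosSqrtCoeff m k * (k * x ^ (k - 1)))
    (t := Metric.ball (0 : ℝ) R) (y₀ := 0) (y := y) hu Metric.isOpen_ball
    (convex_ball _ _).isPreconnected
    (fun k x _ => (hasDerivAt_pow k x).const_mul _) ?_ (by simp [R]; positivity)
    (summable_cosSqrt m 0) (by simp [R])
  · have hs : Summable fun k : ℕ => (-1) ^ k * cosSqrtCoeff m k * (k * y ^ (k - 1)) := by
      rw [← summable_nat_add_iff 1]
      refine (summable_cosSqrt (m + 1) y).neg.congr fun k => ?_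
      rw [← succ_mul_cosSqrtCoeff_succ, Nat.add_sub_cancel]
      push_cast
      ring
    refine key.congr_deriv ?_
    rw [hs.tsum_eq_zero_add, cosSqrt, ← tsum_neg]
    simp only [CharP.cast_eq_zero, zero_mul, mul_zero, zero_add]
    congr 1
    funext k
    rw [← succ_mul_cosSqrtCoeff_succ, Nat.add_sub_cancel]
    push_cast
    ring
  · intro k x hx
    have hx' : |x| ≤ R := by simpa using (Metric.mem_ball.1 hx).le
    rcases k with _ | k
    · simp
    · rw [norm_mul, norm_mul, norm_mul, norm_pow, norm_neg, norm_one, one_pow, one_mul, norm_pow,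
        Real.norm_eq_abs, Real.norm_eq_abs, Real.norm_eq_abs,
        abs_of_nonneg (cosSqrtCoeff_nonneg m _), Nat.add_sub_cancel]
      rw [abs_of_nonneg (by positivity : (0 : ℝ) ≤ ((k + 1 : ℕ) : ℝ))]
      calc cosSqrtCoeff m (k + 1) * (((k + 1 : ℕ) : ℝ) * |x| ^ k)
          = cosSqrtCoeff (m + 1) k * |x| ^ k := by
            rw [← succ_mul_cosSqrtCoeff_succ]; push_cast; ring
        _ ≤ 1 / (k ! : ℝ) * R ^ k := by
            gcongr
            exact cosSqrtCoeff_le _ _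
        _ = R ^ k / k ! := by ring

lemma continuous_cosSqrt (m : ℕ) : Continuous (cosSqrt m) :=
  continuous_iff_continuousAt.2 fun y => (hasDerivAt_cosSqrt m y).continuousAt

/-- This is the m-times differentiated equation 4y g'' + 2g' + g = 0 for g = cos √y, read off from
the coefficients. -/
lemma cosSqrt_recurrence (m : ℕ) (y : ℝ) :
    cosSqrt m y = (4 * m + 2) * cosSqrt (m + 1) y - 4 * y * cosSqrt (m + 2) y := by
  have h1 := (summable_cosSqrt (m + 1) y).hasSum
  have h2 := (summable_cosSqrt (m + 2) y).hasSum
  have h3 : HasSum (fun k : ℕ => (-1) ^ k * (k * cosSqrtCoeff (m + 1) k) * y ^ k)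
      (-(y * cosSqrt (m + 2) y)) := by
    rw [← hasSum_nat_add_iff' 1]
    simp only [Finset.range_one, Finset.sum_singleton, CharP.cast_eq_zero, zero_mul, mul_zero,
      sub_zero]
    refine (h2.mul_left y).neg.congr_fun fun k => ?_
    rw [← succ_mul_cosSqrtCoeff_succ (m + 1) k]
    push_cast
    ring
  have h4 := (h1.mul_left (4 * m + 2 : ℝ)).add (h3.mul_left 4)
  have h5 : HasSum (fun k : ℕ => (-1) ^ k * cosSqrtCoeff m k * y ^ k) (cosSqrt m y) :=
    (summable_cosSqrt m y).hasSum
  refine (h5.unique ?_).trans (b := (4 * m + 2) * cosSqrt (m + 1) y + 4 * -(y * cosSqrt (m + 2) y))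
    (by ring)
  refine h4.congr_fun fun k => ?_
  rw [cosSqrtCoeff_eq m k]
  ring

lemma cosSqrt_zero_sq (x : ℝ) : cosSqrt 0 (x ^ 2) = Real.cos x := by
  refine HasSum.tsum_eq ?_
  convert Real.hasSum_cos x using 1
  funext k
  simp only [cosSqrtCoeff, add_zero, mul_zero, ← pow_mul]
  field_simp

lemma cosSqrt_zero_right (m : ℕ) : cosSqrt m 0 = (4 * m + 2) * cosSqrt (m + 1) 0 := by
  rw [cosSqrt_recurrence]; ring

lemma cosSqrt_zero_right_pos (m : ℕ) : 0 < cosSqrt m 0 := by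
  induction m with
  | zero => have := cosSqrt_zero_sq 0; simp at this; rw [this]; norm_num
  | succ m ih =>
    rw [cosSqrt_zero_right] at ih
    exact pos_of_mul_pos_right ih (by positivity)

/-- The energy `4 y c_{m+1}² + c_m²` is nonincreasing. -/
lemma cosSqrt_energy_le (m : ℕ) {a b : ℝ} (hab : a ≤ b) :
    4 * b * cosSqrt (m + 1) b ^ 2 + cosSqrt m b ^ 2 ≤
      4 * a * cosSqrt (m + 1) a ^ 2 + cosSqrt m a ^ 2 := by
  have hd : ∀ y, HasDerivAt (fun y => 4 * y * cosSqrt (m + 1) y ^ 2 + cosSqrt m y ^ 2)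
      (-(8 * m) * cosSqrt (m + 1) y ^ 2) y := fun y => by
    have h := ((((hasDerivAt_id y).const_mul 4).mul
      ((hasDerivAt_cosSqrt (m + 1) y).pow 2)).add ((hasDerivAt_cosSqrt m y).pow 2))
    refine h.congr_deriv ?_
    rw [cosSqrt_recurrence m y]
    simp
    ring
  have hanti : Antitone fun y => 4 * y * cosSqrt (m + 1) y ^ 2 + cosSqrt m y ^ 2 :=
    antitone_of_hasDerivAt_nonpos hd fun y => by
      simp only [Pi.zero_apply, neg_mul, Left.neg_nonpos_iff]; positivity
  exact hanti hab

lemma abs_cosSqrt_le (m : ℕ) {y : ℝ} (hy : 0 ≤ y) : |cosSqrt m y| ≤ cosSqrt m 0 := by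
  have h := cosSqrt_energy_le m hy
  refine abs_le_of_sq_le_sq ?_ (cosSqrt_zero_right_pos m).le
  have : 0 ≤ 4 * y * cosSqrt (m + 1) y ^ 2 := by positivity
  linarith

lemma cosSqrt_ge (m : ℕ) {y : ℝ} (hy : 0 ≤ y) :
    cosSqrt m 0 - cosSqrt (m + 1) 0 * y ≤ cosSqrt m y := by
  have hd : ∀ t, HasDerivAt (fun t => cosSqrt m t + cosSqrt (m + 1) 0 * t)
      (-cosSqrt (m + 1) t + cosSqrt (m + 1) 0) t := fun t =>
    ((hasDerivAt_cosSqrt m t).add ((hasDerivAt_id t).const_mul (cosSqrt (m + 1) 0))).congr_deriv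
      (by simp)
  have hm : MonotoneOn (fun t => cosSqrt m t + cosSqrt (m + 1) 0 * t) (Set.Ici 0) :=
    monotoneOn_of_hasDerivWithinAt_nonneg (convex_Ici 0)
      (fun t _ => (hd t).continuousAt.continuousWithinAt)
      (fun t _ => (hd t).hasDerivWithinAt) (fun t ht => by
        rw [interior_Ici] at ht
        have := (abs_le.1 (abs_cosSqrt_le (m + 1) (le_of_lt ht))).2
        linarith)
  have := hm (Set.mem_Ici.2 le_rfl) (Set.mem_Ici.2 hy) hy
  simp only [mul_zero, add_zero] at this
  linarith

/-- For m large compared with y, the values at 0 dominate: c_m(y) lies between c_m(0) − y c_{m+1}(0)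
and c_m(0), and c_m(0) = (4m + 2) c_{m+1}(0). This starts the downward induction of `cosSqrt_ratio`.
-/
lemma cosSqrt_ratio_of_large {m : ℕ} {y : ℝ} (hy : 0 ≤ y) (hm : y + 4 ≤ m) :
    0 < cosSqrt (m + 1) y ∧ (2 * m + 1) * cosSqrt (m + 1) y ≤ cosSqrt m y := by
  have h0 := cosSqrt_zero_right m
  have h1 := cosSqrt_zero_right (m + 1)
  have hp := cosSqrt_zero_right_pos (m + 1)
  have hp2 := cosSqrt_zero_right_pos (m + 1 + 1)
  have hge := cosSqrt_ge m hy
  have hge1 := cosSqrt_ge (m + 1) hy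
  have hle := (abs_le.1 (abs_cosSqrt_le (m + 1) hy)).2
  push_cast at h1
  constructor
  · nlinarith
  · have : (2 * m + 1) * cosSqrt (m + 1) y ≤ (2 * m + 1) * cosSqrt (m + 1) 0 := by gcongr
    nlinarith

/-- Downward induction on m: the ratio bound at m + 1 makes the subtracted term 4y c_{m+2} of the
recurrence at most half of (4m + 2) c_{m+1}. -/
lemma cosSqrt_ratio {m : ℕ} {y : ℝ} (hy : 0 ≤ y) (hm : 4 * y ≤ (2 * m + 1) * (2 * m + 3)) :
    0 < cosSqrt (m + 1) y ∧ (2 * m + 1) * cosSqrt (m + 1) y ≤ cosSqrt m y := by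
  obtain ⟨N, hN⟩ := exists_nat_ge (y + 4)
  rcases le_total N m with hNm | hNm
  · exact cosSqrt_ratio_of_large hy (hN.trans (by exact_mod_cast hNm))
  · induction hNm using Nat.decreasingInduction with
    | self => exact cosSqrt_ratio_of_large hy hN
    | of_succ k hk ih =>
      obtain ⟨h1, h2⟩ := ih (by push_cast; nlinarith [(k.cast_nonneg : (0 : ℝ) ≤ k)])
      push_cast at h1 h2
      have hr := cosSqrt_recurrence k y
      have hk0 : (0 : ℝ) ≤ k := k.cast_nonneg
      have hpos : 0 < cosSqrt (k + 1) y := lt_of_lt_of_le (by positivity) h2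
      refine ⟨hpos, ?_⟩
      have : 4 * y * cosSqrt (k + 2) y ≤ (2 * k + 1) * cosSqrt (k + 1) y := by
        calc 4 * y * cosSqrt (k + 2) y ≤ (2 * k + 1) * (2 * k + 3) * cosSqrt (k + 2) y := by
              gcongr
          _ = (2 * k + 1) * ((2 * (k + 1) + 1) * cosSqrt (k + 2) y) := by ring
          _ ≤ _ := by gcongr
      linarith

lemma cosSqrt_pos_of_le {y : ℝ} (hy : 0 ≤ y) (hy' : y ≤ 455) :
    0 < cosSqrt 18 y ∧ 0 < cosSqrt 19 y := by
  -- 21 is the least m with 4 · 455 ≤ (2m + 1)(2m + 3). Three explicit steps of the recurrence then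
  -- descend to 18, with ratio constants that deteriorate but stay positive.
  obtain ⟨h22, h21⟩ := cosSqrt_ratio (m := 21) hy (by norm_num; linarith)
  norm_num at h22 h21
  have r20 := cosSqrt_recurrence 20 y
  have r19 := cosSqrt_recurrence 19 y
  have r18 := cosSqrt_recurrence 18 y
  norm_num at r20 r19 r18
  have p21 : 0 < cosSqrt 21 y := by linarith
  have e20 : 39 * cosSqrt 21 y ≤ cosSqrt 20 y := by nlinarith
  have p20 : 0 < cosSqrt 20 y := by linarith
  have e19 : 31 * cosSqrt 20 y ≤ cosSqrt 19 y := by nlinarith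
  have p19 : 0 < cosSqrt 19 y := by linarith
  exact ⟨by nlinarith, p19⟩

/-- The energy at 320 controls every later value of `cosSqrt 17`, and the drop of this function
between 225 and 320 is large enough to beat it. -/
lemma abs_cosSqrt_seventeen_lt {y : ℝ} (hy : 320 ≤ y) : |cosSqrt 17 y| < cosSqrt 17 225 := by
  obtain ⟨h18, h17⟩ := cosSqrt_ratio (m := 17) (y := 320) (by norm_num) (by norm_num)
  norm_num at h18 h17
  have r17 := cosSqrt_recurrence 17 320
  have p19 := (cosSqrt_pos_of_le (y := 320) (by norm_num) (by norm_num)).2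
  norm_num at r17
  obtain ⟨t, ht, hts⟩ := exists_hasDerivAt_eq_slope (cosSqrt 17) (fun t => -cosSqrt 18 t)
    (a := 225) (b := 320) (by norm_num) (continuous_cosSqrt 17).continuousOn
    (fun t _ => hasDerivAt_cosSqrt 17 t)
  have hanti : AntitoneOn (cosSqrt 18) (Set.Icc 225 320) :=
    antitoneOn_of_hasDerivWithinAt_nonpos (convex_Icc _ _) (continuous_cosSqrt 18).continuousOn
      (fun t _ => (hasDerivAt_cosSqrt 18 t).hasDerivWithinAt) (fun t ht => by
        rw [interior_Icc] at ht
        have := (cosSqrt_pos_of_le (y := t) (by linarith [ht.1]) (by linarith [ht.2])).2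
        exact (neg_neg_of_pos this).le)
  have h18t := hanti (Set.Ioo_subset_Icc_self ht) (Set.right_mem_Icc.2 (by norm_num)) ht.2.le
  have hen := cosSqrt_energy_le 17 (a := 320) hy
  norm_num at hen hts
  -- The drop is at least 95 c₁₈(320), since c₁₈ decreases, and c₁₇(320) < 70 c₁₈(320) by the
  -- recurrence; 1 + 95/70 > 2.3.
  have h3 : 2.3 * cosSqrt 17 320 ≤ cosSqrt 17 225 := by
    field_simp at hts
    linarith
  have h4 : 0 < cosSqrt 17 320 := by linarith
  refine abs_lt_of_sq_lt_sq ?_ (by linarith)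
  have h5 : 0 ≤ 4 * y * cosSqrt 18 y ^ 2 := mul_nonneg (by linarith) (sq_nonneg _)
  clear hts h18t hanti r17 p19
  generalize cosSqrt 17 320 = A at *
  generalize cosSqrt 18 320 = B at *
  generalize cosSqrt 17 225 = C at *
  have h6 : (35 * B) ^ 2 ≤ A ^ 2 := by gcongr
  have h7 : (2.3 * A) ^ 2 ≤ C ^ 2 := by gcongr
  have h8 : 0 < A ^ 2 := by positivity
  rw [mul_pow] at h6 h7
  -- The energy at 320 is at most (1280/35² + 1) c₁₇(320)², and 1280/35² + 1 < 2.3².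
  linarith

/-! ### Rolle's theorem with multiplicities -/

/-- `f 0, f 1, …` vanish along the nodes `z 0 ≤ … ≤ z n`, counted with multiplicity. -/
def VanishesAlong (f : ℕ → ℝ → ℝ) (z : ℕ → ℝ) (n : ℕ) : Prop :=
  ∀ i j, i + j ≤ n → z i = z (i + j) → f j (z i) = 0

/-- In a gap between consecutive zeros, Rolle gives a strictly interior zero of the derivative; at a
repeated zero, the zero itself serves. Strictness ensures that a coincidence w i = w (i + j) with j
> 0 occurs only when z i = z (i + j + 1), so multiplicities drop by exactly one. -/
lemma VanishesAlong.rolle {f : ℕ → ℝ → ℝ} (hf : ∀ j x, HasDerivAt (f j) (f (j + 1) x) x)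
    {z : ℕ → ℝ} (hz : Monotone z) {n : ℕ} (h : VanishesAlong f z (n + 1)) :
    ∃ w : ℕ → ℝ, Monotone w ∧ (∀ i, z i ≤ w i ∧ w i ≤ z (i + 1)) ∧
      VanishesAlong (fun j => f (j + 1)) w n := by
  have step : ∀ i, ∃ w, (z i ≤ w ∧ w ≤ z (i + 1)) ∧
      (i ≤ n → f 1 w = 0 ∧ (z i < z (i + 1) → z i < w ∧ w < z (i + 1))) := by
    intro i
    by_cases hi : i ≤ n
    · rcases (hz (Nat.le_succ i)).eq_or_lt with he | hlt
      · exact ⟨z i, ⟨le_rfl, he.le⟩, fun _ => ⟨h i 1 (by omega) he, fun hl => absurd he hl.ne⟩⟩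
      · obtain ⟨w, hw, hw0⟩ := exists_hasDerivAt_eq_zero hlt
          (fun x _ => (hf 0 x).continuousAt.continuousWithinAt)
          ((h i 0 (by omega) rfl).trans (h (i + 1) 0 (by omega) rfl).symm)
          (fun x _ => hf 0 x)
        exact ⟨w, ⟨hw.1.le, hw.2.le⟩, fun _ => ⟨hw0, fun _ => hw⟩⟩
    -- Filler values beyond the last zero, which only keep the sequence monotone.
    · exact ⟨z i, ⟨le_rfl, hz (Nat.le_succ i)⟩, fun h' => absurd h' hi⟩
  choose w hw hw' using step
  have hmono : Monotone w := monotone_nat_of_le_succ fun i => (hw i).2.trans (hw (i + 1)).1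
  refine ⟨w, hmono, hw, fun i j hij he => ?_⟩
  rcases j with _ | j
  · exact (hw' i (by omega)).1
  · have h1 : z (i + 1) ≤ z (i + (j + 1)) := hz (by omega)
    have e1 : w i = z (i + 1) := le_antisymm (hw i).2 (h1.trans ((hw _).1.trans he.ge))
    have e2 : w (i + (j + 1)) = z (i + (j + 1)) :=
      le_antisymm (he.symm.le.trans ((hw i).2.trans h1)) (hw _).1
    have e3 : z i = z (i + 1) := by
      refine (hz (Nat.le_succ i)).eq_or_lt.resolve_right fun hl => ?_
      exact ((hw' i (by omega)).2 hl).2.ne e1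
    have e4 : z (i + (j + 1)) = z (i + (j + 1) + 1) := by
      refine (hz (Nat.le_succ _)).eq_or_lt.resolve_right fun hl => ?_
      exact ((hw' _ hij).2 hl).1.ne e2.symm
    have e5 : z i = w i := e3.trans e1.symm
    rw [← e5]
    refine h i (j + 1 + 1) (by omega) ?_
    rw [e5, he, e2, e4, add_assoc]

lemma VanishesAlong.rolle_iterate (k : ℕ) : ∀ {f : ℕ → ℝ → ℝ},
    (∀ j x, HasDerivAt (f j) (f (j + 1) x) x) → ∀ {z : ℕ → ℝ}, Monotone z → ∀ {n : ℕ},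
    VanishesAlong f z (n + k) → ∃ w : ℕ → ℝ, Monotone w ∧ (∀ i, z i ≤ w i ∧ w i ≤ z (i + k)) ∧
      VanishesAlong (fun j => f (j + k)) w n := by
  induction k with
  | zero => exact fun _ z hz n h => ⟨z, hz, fun i => ⟨le_rfl, le_rfl⟩, h⟩
  | succ k ih =>
    intro f hf z hz n h
    obtain ⟨w, hw, hwz, hV⟩ := VanishesAlong.rolle hf hz (n := n + k) h
    obtain ⟨v, hv, hvw, hV'⟩ := ih (f := fun j => f (j + 1)) (fun j x => hf (j + 1) x) hw hV
    refine ⟨v, hv, fun i => ⟨(hwz i).1.trans (hvw i).1, (hvw i).2.trans (hwz _).2⟩, ?_⟩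
    simpa [VanishesAlong, add_assoc] using hV'

lemma List.lt_count_of_getElem_eq {l : List ℝ} (hl : l.SortedLE) {i j : ℕ} (h : i + j < l.length)
    (he : l[i] = l[i + j]) : j < l.count l[i] := by
  have hsub : List.Sublist ((l.drop i).take (j + 1)) l :=
    (List.take_sublist _ _).trans (List.drop_sublist _ _)
  have hrep : (l.drop i).take (j + 1) = List.replicate (j + 1) l[i] := by
    refine List.ext_getElem (by simp; omega) fun t h1 h2 => ?_
    simp only [List.length_replicate] at h2
    simp only [List.getElem_take, List.getElem_drop, List.getElem_replicate]
    refine le_antisymm ?_ (hl.getElem_le_getElem_of_le (by omega))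
    rw [he]
    exact hl.getElem_le_getElem_of_le (by omega)
  have := hsub.count_le l[i]
  rw [hrep, List.count_replicate_self] at this
  omega

/-- Sorting a multiset of zeros turns it into a monotone sequence of zeros. -/
lemma exists_vanishesAlong {f : ℕ → ℝ → ℝ} {M : Multiset ℝ} {n : ℕ} (hM : M.card = n + 1)
    (h : ∀ a ∈ M, ∀ j < M.count a, f j a = 0) :
    ∃ z : ℕ → ℝ, Monotone z ∧ (∀ i, z i ∈ M) ∧ VanishesAlong f z n := by
  have hlen : (M.sort (· ≤ ·)).length = n + 1 := by rw [Multiset.length_sort, hM]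
  have hs : (M.sort (· ≤ ·)).SortedLE := (Multiset.pairwise_sort ..).sortedLE
  have hcoe : ((M.sort (· ≤ ·) : List ℝ) : Multiset ℝ) = M := Multiset.sort_eq ..
  generalize M.sort (· ≤ ·) = l at *
  -- The finite sorted list is continued by its last entry.
  refine ⟨fun i => l[min i n]'(by omega), fun a b hab =>
    hs.getElem_le_getElem_of_le (by omega), fun i => ?_, fun i j hij he => ?_⟩
  · rw [← hcoe, Multiset.mem_coe]
    exact List.getElem_mem _
  · have hi : min i n = i := by omega
    have hj : min (i + j) n = i + j := by omega
    simp only [hi, hj] at he ⊢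
    refine h _ (by rw [← hcoe, Multiset.mem_coe]; exact List.getElem_mem _) j ?_
    rw [← hcoe, Multiset.coe_count]
    exact List.lt_count_of_getElem_eq hs (by omega) he

/-- `n + 1` zeros of a function, counted with multiplicity, give a zero of its `n`-th derivative. -/
theorem exists_iterated_deriv_zero {f : ℕ → ℝ → ℝ}
    (hf : ∀ j x, HasDerivAt (f j) (f (j + 1) x) x) {M : Multiset ℝ} {n : ℕ}
    (hM : M.card = n + 1) (h : ∀ a ∈ M, ∀ j < M.count a, f j a = 0) {a b : ℝ}
    (hab : ∀ x ∈ M, x ∈ Set.Icc a b) : ∃ u ∈ Set.Icc a b, f n u = 0 := by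
  obtain ⟨z, hz, hzM, hV⟩ := exists_vanishesAlong hM h
  obtain ⟨w, -, hwz, hV'⟩ := VanishesAlong.rolle_iterate n hf hz (n := 0) (by simpa using hV)
  refine ⟨w 0, ⟨(hab _ (hzM 0)).1.trans (hwz 0).1, (hwz 0).2.trans (hab _ (hzM _)).2⟩, ?_⟩
  simpa using hV' 0 0 le_rfl rfl

/-- `n + 2` zeros of a function, counted with multiplicity, give two zeros of its `n`-th
derivative, counted with multiplicity. -/
theorem exists_iterated_deriv_two_zeros {f : ℕ → ℝ → ℝ}
    (hf : ∀ j x, HasDerivAt (f j) (f (j + 1) x) x) {M : Multiset ℝ} {n : ℕ}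
    (hM : M.card = n + 2) (h : ∀ a ∈ M, ∀ j < M.count a, f j a = 0) {a : ℝ}
    (hab : ∀ x ∈ M, a ≤ x) :
    ∃ u v, a ≤ u ∧ u ≤ v ∧ f n u = 0 ∧ f n v = 0 ∧ (u = v → f (n + 1) u = 0) := by
  obtain ⟨z, hz, hzM, hV⟩ := exists_vanishesAlong hM h
  obtain ⟨w, hw, hwz, hV'⟩ := VanishesAlong.rolle_iterate n hf hz (n := 1)
    (by rwa [add_comm])
  refine ⟨w 0, w 1, (hab _ (hzM 0)).trans (hwz 0).1, hw zero_le_one, ?_, ?_, fun he => ?_⟩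
  · simpa using hV' 0 0 (by omega) rfl
  · simpa using hV' 1 0 (by omega) rfl
  · simpa [add_comm] using hV' 0 1 (by omega) he

/-! ### Pulling zeros back along x ↦ x² -/

lemma hasDerivAt_eval_iterate_derivative (P : ℝ[X]) (j : ℕ) (x : ℝ) :
    HasDerivAt (fun x => (derivative^[j] P).eval x) ((derivative^[j + 1] P).eval x) x := by
  rw [Function.iterate_succ_apply']
  exact (derivative^[j] P).hasDerivAt x

lemma iteratedDeriv_polynomial_eval (P : ℝ[X]) (j : ℕ) :
    iteratedDeriv j (fun x => P.eval x) = fun x => (derivative^[j] P).eval x := by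
  induction j with
  | zero => simp
  | succ j ih =>
    rw [iteratedDeriv_succ, ih]
    exact funext fun x => (hasDerivAt_eval_iterate_derivative P j x).deriv

lemma contDiff_of_hasDerivAt_family {f : ℕ → ℝ → ℝ}
    (hf : ∀ j x, HasDerivAt (f j) (f (j + 1) x) x) (k n : ℕ) : ContDiff ℝ k (f n) := by
  induction k generalizing n with
  | zero => exact contDiff_zero.2 (continuous_iff_continuousAt.2 fun x => (hf n x).continuousAt)
  | succ k ih =>
    have : deriv (f n) = f (n + 1) := funext fun x => (hf n x).deriv
    push_cast
    refine contDiff_succ_iff_deriv.2 ⟨fun x => (hf n x).differentiableAt, by simp, ?_⟩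
    rw [this]
    exact ih _

/-- A zero of multiplicity `m` of `f` at `x ^ 2` gives a zero of multiplicity at least `m` of
`q (x) f (x ^ 2)` at `x`. -/
lemma iteratedDeriv_comp_sq_eq_zero {f : ℕ → ℝ → ℝ}
    (hf : ∀ j x, HasDerivAt (f j) (f (j + 1) x) x) {x : ℝ} {m : ℕ}
    (h : ∀ i < m, f i (x ^ 2) = 0) (j : ℕ) : ∀ (n : ℕ) (q : ℝ[X]), n + j < m →
    iteratedDeriv j (fun t => q.eval t * f n (t ^ 2)) x = 0 := by
  induction j with
  | zero => intro n q hn; simp [h n hn]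
  | succ j ih =>
    intro n q hn
    -- The derivative is a sum of two functions of the same shape; the polynomial factor q is
    -- carried so that the induction closes.
    have hd : deriv (fun t => q.eval t * f n (t ^ 2)) =
        fun t => (derivative q).eval t * f n (t ^ 2) +
          (q * (2 * X)).eval t * f (n + 1) (t ^ 2) := by
      funext t
      refine ((q.hasDerivAt t).mul ((hf n (t ^ 2)).comp t (hasDerivAt_pow 2 t))).deriv.trans ?_
      simp
      ring
    have hc : ∀ (n : ℕ) (q : ℝ[X]), ContDiff ℝ j fun t => q.eval t * f n (t ^ 2) := fun n q =>
      (contDiff_of_hasDerivAt_family (hasDerivAt_eval_iterate_derivative q) j 0).mul ((contDiff_of_hasDerivAt_family hf j n).comp (contDiff_id.pow 2))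
    rw [iteratedDeriv_succ', hd,
      iteratedDeriv_fun_add (hc n _).contDiffAt (hc (n + 1) _).contDiffAt,
      ih n _ (by omega), ih (n + 1) _ (by omega), add_zero]

lemma iteratedDeriv_two_comp_sq_zero {f : ℕ → ℝ → ℝ}
    (hf : ∀ j x, HasDerivAt (f j) (f (j + 1) x) x) (h : f 1 0 = 0) :
    iteratedDeriv 2 (fun t => f 0 (t ^ 2)) 0 = 0 := by
  have hd : ∀ n t, HasDerivAt (fun t => f n (t ^ 2)) (f (n + 1) (t ^ 2) * (2 * t)) t := fun n t =>
    ((hf n (t ^ 2)).comp t (hasDerivAt_pow 2 t)).congr_deriv (by simp)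
  rw [iteratedDeriv_succ, iteratedDeriv_one, show deriv (fun t => f 0 (t ^ 2)) =
    fun t => f 1 (t ^ 2) * (2 * t) from funext fun t => (hd 0 t).deriv]
  refine ((hd 1 0).mul ((hasDerivAt_id (0 : ℝ)).const_mul 2)).deriv.trans ?_
  simp [h]

/-! ### Hermite interpolation over a multiset of nodes -/

/-- The multiset of nodes with the multiplicities given by a list of pairs. -/
def nodeMultiset (l : List (ℝ × ℕ)) : Multiset ℝ :=
  (l.map fun p => Multiset.replicate p.2 p.1).sum

lemma nodeMultiset_cons (p : ℝ × ℕ) (l : List (ℝ × ℕ)) :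
    nodeMultiset (p :: l) = Multiset.replicate p.2 p.1 + nodeMultiset l := by
  simp [nodeMultiset]

lemma exists_of_mem_nodeMultiset {l : List (ℝ × ℕ)} {a : ℝ} (h : a ∈ nodeMultiset l) :
    ∃ p ∈ l, p.1 = a := by
  induction l with
  | nil => simp [nodeMultiset] at h
  | cons p l ih =>
    rw [nodeMultiset_cons, Multiset.mem_add] at h
    rcases h with h | h
    · exact ⟨p, by simp, (Multiset.eq_of_mem_replicate h).symm⟩
    · obtain ⟨q, hq, he⟩ := ih h
      exact ⟨q, by simp [hq], he⟩

lemma count_nodeMultiset {l : List (ℝ × ℕ)} (hl : (l.map Prod.fst).Nodup) {p : ℝ × ℕ}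
    (hp : p ∈ l) : (nodeMultiset l).count p.1 = p.2 := by
  induction l with
  | nil => simp at hp
  | cons q l ih =>
    rw [List.map_cons, List.nodup_cons] at hl
    rw [nodeMultiset_cons, Multiset.count_add, Multiset.count_replicate]
    rcases List.mem_cons.1 hp with rfl | hp
    · rw [if_pos rfl, Multiset.count_eq_zero.2, add_zero]
      intro h
      obtain ⟨r, hr, he⟩ := exists_of_mem_nodeMultiset h
      exact hl.1 (List.mem_map.2 ⟨r, hr, he⟩)
    · rw [if_neg, zero_add, ih hl.2 hp]
      intro he
      exact hl.1 (List.mem_map.2 ⟨p, hp, he.symm⟩)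

lemma forall_nodeMultiset_iff {l : List (ℝ × ℕ)} (hl : (l.map Prod.fst).Nodup)
    {Q : ℕ → ℝ → Prop} :
    (∀ a ∈ nodeMultiset l, ∀ j < (nodeMultiset l).count a, Q j a) ↔
      ∀ p ∈ l, ∀ j < p.2, Q j p.1 := by
  constructor
  · intro h p hp j hj
    have hc := count_nodeMultiset hl hp
    refine h p.1 ?_ j (by rwa [hc])
    rw [← Multiset.count_pos]
    omega
  · intro h a ha j hj
    obtain ⟨p, hp, rfl⟩ := exists_of_mem_nodeMultiset ha
    rw [count_nodeMultiset hl hp] at hj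
    exact h p hp j hj

lemma eq_zero_of_iterate_derivative_eval_eq_zero {q : ℝ[X]} {M : Multiset ℝ}
    (hdeg : q.natDegree < M.card)
    (h : ∀ a ∈ M, ∀ j < M.count a, (derivative^[j] q).eval a = 0) : q = 0 := by
  by_contra hq
  have hle : M ≤ q.roots := by
    rw [Multiset.le_iff_count]
    intro a
    rw [count_roots]
    rcases Nat.eq_zero_or_pos (M.count a) with h0 | h0
    · omega
    · have := lt_rootMultiplicity_of_isRoot_iterate_derivative hq (n := M.count a - 1) (t := a)
        fun j hj => h a (Multiset.count_pos.1 h0) j (by omega)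
      omega
  have := Multiset.card_le_card hle
  have := q.card_roots'
  omega

/-- Existence of Hermite interpolating polynomials. -/
lemma exists_hermite_interpolant {M : Multiset ℝ} (hM : 0 < M.card) (v : ℕ → ℝ → ℝ) :
    ∃ P : ℝ[X], P.natDegree < M.card ∧
      ∀ a ∈ M, ∀ j < M.count a, (derivative^[j] P).eval a = v j a := by
  let ι := Σ a : M.toFinset, Fin (M.count (a : ℝ))
  -- One coordinate per interpolation condition. The dimensions agree, so injectivity (uniqueness)
  -- yields surjectivity (existence).
  let L : degreeLT ℝ M.card →ₗ[ℝ] ι → ℝ := LinearMap.pi fun i =>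
    (leval (i.1 : ℝ)) ∘ₗ (derivative ^ (i.2 : ℕ)) ∘ₗ (degreeLT ℝ M.card).subtype
  have hL : ∀ q i, L q i = (derivative^[(i.2 : ℕ)] (q : ℝ[X])).eval (i.1 : ℝ) := fun q i => by
    simp [L, Module.End.pow_apply]
  have hdeg : ∀ q ∈ degreeLT ℝ M.card, q.natDegree < M.card := fun q hq => by
    rcases eq_or_ne q 0 with rfl | h0
    · simpa using hM
    · exact (natDegree_lt_iff_degree_lt h0).2 (mem_degreeLT.1 hq)
  have hinj : Function.Injective L := by
    rw [← LinearMap.ker_eq_bot, LinearMap.ker_eq_bot']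
    intro q hq
    refine Subtype.ext (eq_zero_of_iterate_derivative_eval_eq_zero (hdeg q q.2) fun a ha j hj => ?_)
    have := congrFun hq ⟨⟨a, Multiset.mem_toFinset.2 ha⟩, ⟨j, hj⟩⟩
    rwa [hL] at this
  have hfin : Module.finrank ℝ (degreeLT ℝ M.card) = Module.finrank ℝ (ι → ℝ) := by
    rw [(degreeLTEquiv ℝ M.card).finrank_eq, Module.finrank_fin_fun, Module.finrank_pi,
      Fintype.card_sigma]
    simp only [Fintype.card_fin]
    rw [Finset.sum_coe_sort M.toFinset (fun a => M.count a), Multiset.toFinset_sum_count_eq]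
  have : FiniteDimensional ℝ (degreeLT ℝ M.card) :=
    Module.Finite.equiv (degreeLTEquiv ℝ M.card).symm
  obtain ⟨q, hq⟩ := (LinearMap.injective_iff_surjective_of_finrank_eq_finrank hfin).1 hinj
    fun i => v i.2 i.1
  refine ⟨q, hdeg q q.2, fun a ha j hj => ?_⟩
  have := congrFun hq ⟨⟨a, Multiset.mem_toFinset.2 ha⟩, ⟨j, hj⟩⟩
  rwa [hL] at this

/-! ### Sign of the interpolation error in the variable y -/

lemma antitoneOn_cosSqrt_eighteen : AntitoneOn (cosSqrt 18) (Set.Icc 0 455) :=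
  antitoneOn_of_hasDerivWithinAt_nonpos (convex_Icc _ _) (continuous_cosSqrt 18).continuousOn
    (fun t _ => (hasDerivAt_cosSqrt 18 t).hasDerivWithinAt) fun t ht => by
      rw [interior_Icc] at ht
      exact (neg_neg_of_pos (cosSqrt_pos_of_le ht.1.le ht.2.le).2).le

/-- Convexity of `cosSqrt 17` on [0, 455]: its derivative −`cosSqrt 18` increases there. -/
lemma cosSqrt_seventeen_tangent_le {a u : ℝ} (ha : a ∈ Set.Icc (0 : ℝ) 455)
    (hu : u ∈ Set.Icc (0 : ℝ) 455) :
    cosSqrt 17 a - cosSqrt 18 a * (u - a) ≤ cosSqrt 17 u := by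
  rcases lt_trichotomy u a with h | rfl | h
  · obtain ⟨t, ht, hts⟩ := exists_hasDerivAt_eq_slope (cosSqrt 17) (fun t => -cosSqrt 18 t) h
      (continuous_cosSqrt 17).continuousOn (fun t _ => hasDerivAt_cosSqrt 17 t)
    have := antitoneOn_cosSqrt_eighteen (a := t) (b := a)
      ⟨hu.1.trans ht.1.le, ht.2.le.trans ha.2⟩ ha ht.2.le
    rw [eq_div_iff (by linarith)] at hts
    nlinarith
  · simp
  · obtain ⟨t, ht, hts⟩ := exists_hasDerivAt_eq_slope (cosSqrt 17) (fun t => -cosSqrt 18 t) h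
      (continuous_cosSqrt 17).continuousOn (fun t _ => hasDerivAt_cosSqrt 17 t)
    have := antitoneOn_cosSqrt_eighteen (a := a) (b := t) ha
      ⟨ha.1.trans ht.1.le, ht.2.le.trans hu.2⟩ ht.1.le
    rw [eq_div_iff (by linarith)] at hts
    nlinarith

lemma eval_iterate_derivative_of_natDegree_le_succ {Q : ℝ[X]} {n : ℕ} (h : Q.natDegree ≤ n + 1)
    (y : ℝ) : (derivative^[n] Q).eval y = n ! * Q.coeff n + (n + 1)! * Q.coeff (n + 1) * y := by
  have hd : (derivative^[n] Q).natDegree ≤ 1 :=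
    (natDegree_iterate_derivative Q n).trans (by omega)
  rw [eq_X_add_C_of_natDegree_le_one hd, coeff_iterate_derivative, coeff_iterate_derivative,
    zero_add, Nat.descFactorial_self, add_comm 1 n]
  have : (n + 1).descFactorial n = (n + 1)! := by
    have := Nat.factorial_mul_descFactorial (Nat.le_succ n)
    simpa using this
  rw [this]
  simp
  ring

/-- The monic polynomial whose multiset of roots is `M`. -/
noncomputable def nodalPolynomial (M : Multiset ℝ) : ℝ[X] := (M.map fun a => X - C a).prod

lemma iterate_derivative_nodalPolynomial_eval_eq_zero {M : Multiset ℝ} {a : ℝ} {j : ℕ}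
    (hj : j < M.count a) : (derivative^[j] (nodalPolynomial M)).eval a = 0 := by
  refine isRoot_iterate_derivative_of_lt_rootMultiplicity ?_
  rwa [← count_roots, nodalPolynomial, roots_multiset_prod_X_sub_C]

lemma natDegree_nodalPolynomial (M : Multiset ℝ) : (nodalPolynomial M).natDegree = M.card :=
  natDegree_multiset_prod_X_sub_C_eq_card M

lemma coeff_nodalPolynomial_card (M : Multiset ℝ) : (nodalPolynomial M).coeff M.card = 1 := by
  rw [← natDegree_nodalPolynomial]
  exact monic_multiset_prod_of_monic _ _ fun a _ => monic_X_sub_C a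

/-- The derivatives of `cos √y - P y - κ ω y`, with `ω` the nodal polynomial of `M`. -/
noncomputable def hermiteError (M : Multiset ℝ) (P : ℝ[X]) (κ : ℝ) (j : ℕ) (y : ℝ) : ℝ :=
  (-1) ^ j * cosSqrt j y - (derivative^[j] P).eval y -
    κ * (derivative^[j] (nodalPolynomial M)).eval y

lemma hasDerivAt_hermiteError (M : Multiset ℝ) (P : ℝ[X]) (κ : ℝ) (j : ℕ) (y : ℝ) :
    HasDerivAt (hermiteError M P κ j) (hermiteError M P κ (j + 1) y) y := by
  refine ((((hasDerivAt_cosSqrt j y).const_mul ((-1) ^ j)).sub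
    (hasDerivAt_eval_iterate_derivative P j y)).sub
    ((hasDerivAt_eval_iterate_derivative (nodalPolynomial M) j y).const_mul κ)).congr_deriv ?_
  rw [hermiteError]
  ring

/-- `P` interpolates `cos √y` at the nodes `M`, which number `18` with multiplicity, lie in
`[0, 455]` and have mean at most `225`. -/
structure IsCosSqrtInterpolant (M : Multiset ℝ) (P : ℝ[X]) : Prop where
  card : M.card = 18
  mem_Icc : ∀ a ∈ M, a ∈ Set.Icc (0 : ℝ) 455
  sum_le : M.sum ≤ 4050
  natDegree_lt : P.natDegree < 18
  eval_eq : ∀ a ∈ M, ∀ j < M.count a, (derivative^[j] P).eval a = (-1) ^ j * cosSqrt j a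

namespace IsCosSqrtInterpolant

variable {M : Multiset ℝ} {P : ℝ[X]}

lemma hermiteError_eq_zero (h : IsCosSqrtInterpolant M P) (κ : ℝ) :
    ∀ a ∈ M, ∀ j < M.count a, hermiteError M P κ j a = 0 := fun a ha j hj => by
  rw [hermiteError, h.eval_eq a ha j hj, iterate_derivative_nodalPolynomial_eval_eq_zero hj]
  ring

lemma hermiteError_seventeen (h : IsCosSqrtInterpolant M P) (κ y : ℝ) :
    hermiteError M P κ 17 y =
      -cosSqrt 17 y - 17! * P.coeff 17 - κ * 17! * (18 * y - M.sum) := by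
  have h1 := eval_iterate_derivative_of_natDegree_le_succ (n := 17) (h.natDegree_lt.le) y
  rw [coeff_eq_zero_of_natDegree_lt (n := 17 + 1) h.natDegree_lt] at h1
  have h2 := eval_iterate_derivative_of_natDegree_le_succ (Q := nodalPolynomial M) (n := 17)
    (by rw [natDegree_nodalPolynomial, h.card]) y
  have h3 := coeff_nodalPolynomial_card M
  have h4 : (nodalPolynomial M).coeff (M.card - 1) = -M.sum :=
    multiset_prod_X_sub_C_coeff_card_pred M (by rw [h.card]; norm_num)
  rw [h.card] at h3 h4
  norm_num only at h3 h4 h2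
  rw [h3, h4] at h2
  rw [hermiteError, h1, h2, Nat.factorial_succ 17]
  push_cast
  ring

lemma hermiteError_eighteen (h : IsCosSqrtInterpolant M P) (κ y : ℝ) :
    hermiteError M P κ 18 y = cosSqrt 18 y - κ * 17! * 18 := by
  refine (hasDerivAt_hermiteError M P κ 17 y).unique ?_
  rw [show hermiteError M P κ 17 = _ from funext (h.hermiteError_seventeen κ)]
  refine (((hasDerivAt_cosSqrt 17 y).neg.sub_const _).sub
    ((((hasDerivAt_id y).const_mul 18).sub_const _).const_mul (κ * (17! : ℝ)))).congr_deriv ?_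
  ring

/-- A bound for the leading coefficient, by Jensen's inequality. -/
lemma leadingCoeff_le (h : IsCosSqrtInterpolant M P) :
    17! * P.coeff 17 ≤ -cosSqrt 17 225 := by
  -- This κ gives κω the 17th derivative c₁₈(225)(y − mean of the nodes). Its slope cancels that of
  -- the tangent to c₁₇ at 225, so the unknown point u disappears from the estimate.
  obtain ⟨u, hu, h0⟩ := exists_iterated_deriv_zero
    (hasDerivAt_hermiteError M P (cosSqrt 18 225 / (17! * 18))) (n := 17) h.card
    (h.hermiteError_eq_zero _) h.mem_Icc
  rw [h.hermiteError_seventeen] at h0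
  have ht := cosSqrt_seventeen_tangent_le (a := 225) ⟨by norm_num, by norm_num⟩ hu
  have hp := (cosSqrt_pos_of_le (y := 225) (by norm_num) (by norm_num)).1
  have he : cosSqrt 18 225 / (17! * 18) * 17! * (18 * u - M.sum) =
      cosSqrt 18 225 * (u - M.sum / 18) := by
    have : ((17! : ℕ) : ℝ) ≠ 0 := by positivity
    field_simp
  rw [he] at h0
  have hs := h.sum_le
  have : cosSqrt 18 225 * (M.sum / 18) ≤ cosSqrt 18 225 * 225 :=
    mul_le_mul_of_nonneg_left (by linarith) hp.le
  clear he
  generalize ((17! : ℕ) : ℝ) * P.coeff 17 = k at *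
  generalize cosSqrt 18 225 = B at *
  generalize cosSqrt 17 225 = A at *
  linarith

lemma hermiteError_seventeen_pos (h : IsCosSqrtInterpolant M P) {κ y : ℝ} (hκ : κ ≤ 0)
    (hy : 455 ≤ y) : 0 < hermiteError M P κ 17 y := by
  rw [h.hermiteError_seventeen]
  have h1 := (abs_lt.1 (abs_cosSqrt_seventeen_lt (y := y) (by linarith))).2
  have h2 := h.leadingCoeff_le
  have h3 : 0 ≤ -κ * 17! * (18 * y - M.sum) :=
    mul_nonneg (mul_nonneg (by linarith) (by positivity)) (by linarith [h.sum_le])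
  linarith

/-- Nonvanishing of this coefficient makes the degree of P(x²) exactly 34. -/
lemma coeff_neg (h : IsCosSqrtInterpolant M P) : P.coeff 17 < 0 := by
  have h1 := h.leadingCoeff_le
  have h2 := (abs_nonneg _).trans_lt (abs_cosSqrt_seventeen_lt (le_refl 320))
  have h3 : (0 : ℝ) < 17! := by positivity
  by_contra! hc
  have := mul_nonneg h3.le hc
  linarith

/-- The error of the interpolation has the sign of the nodal polynomial. -/
theorem eval_lt (h : IsCosSqrtInterpolant M P) {y : ℝ} (hy : 0 ≤ y)
    (hω : 0 < (nodalPolynomial M).eval y) : P.eval y < cosSqrt 0 y := by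
  by_contra! hc
  -- With this κ the error vanishes at y too, a 19th zero.
  set κ : ℝ := (cosSqrt 0 y - P.eval y) / (nodalPolynomial M).eval y with hκ_def
  have hκ : κ ≤ 0 := div_nonpos_of_nonpos_of_nonneg (by linarith) hω.le
  have hyM : y ∉ M := fun hm => by
    have := iterate_derivative_nodalPolynomial_eval_eq_zero (Multiset.count_pos.2 hm)
    simp only [Function.iterate_zero, id] at this
    exact hω.ne' this
  obtain ⟨u, v, hu, huv, hu0, hv0, huv0⟩ := exists_iterated_deriv_two_zeros
    (hasDerivAt_hermiteError M P κ) (M := y ::ₘ M) (n := 17) (by simp [h.card]) (a := 0) (by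
      intro a ha j hj
      rcases Multiset.mem_cons.1 ha with rfl | ha
      · rw [Multiset.count_cons_self, Multiset.count_eq_zero_of_notMem hyM] at hj
        obtain rfl : j = 0 := by omega
        simp only [hermiteError, pow_zero, one_mul, Function.iterate_zero, id, hκ_def]
        field_simp
        ring
      · rw [Multiset.count_cons_of_ne (fun he : a = y => hyM (he ▸ ha))] at hj
        exact h.hermiteError_eq_zero κ a ha j hj)
    (by
      intro a ha
      rcases Multiset.mem_cons.1 ha with rfl | ha
      · exact hy
      · exact (h.mem_Icc a ha).1)
  have hv : v ≤ 455 := by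
    by_contra! hlt
    exact (h.hermiteError_seventeen_pos hκ hlt.le).ne' hv0
  -- Strict monotonicity of the 17th derivative on [0, 455] excludes two zeros there, and a double
  -- one.
  have hpos : ∀ t, 0 ≤ t → t ≤ 455 → 0 < hermiteError M P κ 18 t := fun t h0 h1 => by
    rw [h.hermiteError_eighteen]
    have h2 := (cosSqrt_pos_of_le h0 h1).1
    have h3 : 0 ≤ -κ * (17! : ℝ) := mul_nonneg (by linarith) (by positivity)
    linarith
  rcases huv.eq_or_lt with he | hlt
  · exact (hpos u hu (huv.trans hv)).ne' (huv0 he)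
  · obtain ⟨t, ht, ht0⟩ := exists_hasDerivAt_eq_zero hlt
      (fun x _ => (hasDerivAt_hermiteError M P κ 17 x).continuousAt.continuousWithinAt)
      (hu0.trans hv0.symm) (fun x _ => hasDerivAt_hermiteError M P κ 17 x)
    exact (hpos t (hu.trans ht.1.le) (ht.2.le.trans hv)).ne' ht0

end IsCosSqrtInterpolant

/-! ### The overlap as a trigonometric sum -/

/-- Fifteen times the overlap `⟨φ(0)|φ(τ)⟩`, which is real. -/
noncomputable def overlap (τ : ℝ) : ℝ := 7 + 4 * Real.cos τ + 4 * Real.cos (11 * τ / 5)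

/-- The derivative of `overlap`. -/
noncomputable def overlapDeriv (τ : ℝ) : ℝ :=
  -4 * Real.sin τ - 44 / 5 * Real.sin (11 * τ / 5)

lemma inner_evolvedState (τ : ℝ) :
    inner ℂ initialState (evolvedState τ) = ((overlap τ / 15 : ℝ) : ℂ) := by
  have hexp : NormedSpace.exp ((-(Complex.I * (τ : ℂ))) • hamiltonian) =
      Matrix.diagonal fun k => Complex.exp (-(Complex.I * (τ : ℂ)) * (energy k : ℂ)) := by
    rw [hamiltonian, ← Matrix.diagonal_smul, Matrix.exp_diagonal]
    congr 1
    funext k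
    simp [Pi.coe_exp, Complex.exp_eq_exp_ℂ]
  have h7 : ((√7 / √15 : ℝ) : ℂ) * ((√7 / √15 : ℝ) : ℂ) = 7 / 15 := by
    rw [← Complex.ofReal_mul, div_mul_div_comm, Real.mul_self_sqrt (by norm_num),
      Real.mul_self_sqrt (by norm_num)]
    push_cast
    rfl
  have h2 : ((√2 / √15 : ℝ) : ℂ) * ((√2 / √15 : ℝ) : ℂ) = 2 / 15 := by
    rw [← Complex.ofReal_mul, div_mul_div_comm, Real.mul_self_sqrt (by norm_num),
      Real.mul_self_sqrt (by norm_num)]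
    push_cast
    rfl
  have hcos : ∀ θ : ℝ, Complex.exp (Complex.I * θ) + Complex.exp (-(Complex.I * θ)) =
      2 * (Real.cos θ : ℂ) := fun θ => by
    rw [Complex.ofReal_cos, Complex.two_cos, mul_comm Complex.I, neg_mul]
  rw [evolvedState, hexp]
  simp only [PiLp.inner_apply, RCLike.inner_apply, Matrix.mulVec_diagonal, initialState,
    Fin.sum_univ_five, energy, Complex.conj_ofReal]
  simp only [Matrix.cons_val]
  have e1 := hcos τ
  have e2 := hcos (11 * τ / 5)
  have a0 : Complex.exp (-(Complex.I * (τ : ℂ)) * ((0 : ℝ) : ℂ)) = 1 := by simp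
  have a1 : -(Complex.I * (τ : ℂ)) * ((-1 : ℝ) : ℂ) = Complex.I * (τ : ℂ) := by push_cast; ring
  have a2 : -(Complex.I * (τ : ℂ)) * ((1 : ℝ) : ℂ) = -(Complex.I * (τ : ℂ)) := by push_cast; ring
  have a3 : -(Complex.I * (τ : ℂ)) * ((-(11 / 5) : ℝ) : ℂ) =
      Complex.I * ((11 * τ / 5 : ℝ) : ℂ) := by push_cast; ring
  have a4 : -(Complex.I * (τ : ℂ)) * ((11 / 5 : ℝ) : ℂ) =
      -(Complex.I * ((11 * τ / 5 : ℝ) : ℂ)) := by push_cast; ring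
  have a5 : ((overlap τ / 15 : ℝ) : ℂ) =
      (7 + 4 * (Real.cos τ : ℂ) + 4 * (Real.cos (11 * τ / 5) : ℂ)) / 15 := by
    rw [overlap]
    push_cast
    rfl
  rw [a0, a1, a2, a3, a4, a5]
  linear_combination h7 + (2 / 15) * e1 + (2 / 15) * e2 +
    (Complex.exp (Complex.I * (τ : ℂ)) + Complex.exp (-(Complex.I * (τ : ℂ))) +
      Complex.exp (Complex.I * ((11 * τ / 5 : ℝ) : ℂ)) +
      Complex.exp (-(Complex.I * ((11 * τ / 5 : ℝ) : ℂ)))) * h2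

lemma rootFidelity_eq (τ : ℝ) : rootFidelity τ = |overlap τ| / 15 := by
  rw [rootFidelity, inner_evolvedState, Complex.norm_real, Real.norm_eq_abs, abs_div]
  norm_num

lemma hasDerivAt_overlap (τ : ℝ) : HasDerivAt overlap (overlapDeriv τ) τ := by
  have h : HasDerivAt (fun t : ℝ => 11 * t / 5) (11 / 5) τ := by
    simpa using ((hasDerivAt_id τ).const_mul 11).div_const 5
  refine ((((Real.hasDerivAt_cos τ).const_mul 4).const_add 7).add
    (h.cos.const_mul 4)).congr_deriv ?_
  rw [overlapDeriv]
  ring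

lemma hasDerivAt_overlapDeriv (τ : ℝ) :
    HasDerivAt overlapDeriv (-4 * Real.cos τ - 484 / 25 * Real.cos (11 * τ / 5)) τ := by
  have h : HasDerivAt (fun t : ℝ => 11 * t / 5) (11 / 5) τ := by
    simpa using ((hasDerivAt_id τ).const_mul 11).div_const 5
  refine (((Real.hasDerivAt_sin τ).const_mul (-4)).sub
    (h.sin.const_mul (44 / 5))).congr_deriv ?_
  ring

lemma continuous_overlap : Continuous overlap :=
  continuous_iff_continuousAt.2 fun τ => (hasDerivAt_overlap τ).continuousAt

lemma continuous_overlapDeriv : Continuous overlapDeriv :=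
  continuous_iff_continuousAt.2 fun τ => (hasDerivAt_overlapDeriv τ).continuousAt

/-! ### Explicit bounds for sine and cosine -/

lemma le_of_hasDerivAt_le {f g f' g' : ℝ → ℝ} (hf : ∀ x, HasDerivAt f (f' x) x)
    (hg : ∀ x, HasDerivAt g (g' x) x) (h0 : f 0 = g 0) (h : ∀ x, 0 ≤ x → f' x ≤ g' x)
    {x : ℝ} (hx : 0 ≤ x) : f x ≤ g x := by
  have hm : MonotoneOn (fun t => g t - f t) (Set.Ici 0) :=
    monotoneOn_of_hasDerivWithinAt_nonneg (convex_Ici 0)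
      (fun t _ => ((hg t).sub (hf t)).continuousAt.continuousWithinAt)
      (fun t _ => ((hg t).sub (hf t)).hasDerivWithinAt) (fun t ht => by
        rw [interior_Ici] at ht
        exact sub_nonneg.2 (h t (le_of_lt ht)))
  have := hm (Set.mem_Ici.2 le_rfl) (Set.mem_Ici.2 hx) hx
  simp only [h0, sub_self] at this
  linarith

section TaylorBounds

variable {x : ℝ}

lemma Real.sin_ge_cubic (hx : 0 ≤ x) : x - x ^ 3 / 6 ≤ Real.sin x := by
  refine le_of_hasDerivAt_le (f := fun x => x - x ^ 3 / 6) (f' := fun x => 1 - x ^ 2 / 2)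
    (fun t => ?_) Real.hasDerivAt_sin (by simp) (fun t _ => Real.one_sub_sq_div_two_le_cos) hx
  refine ((hasDerivAt_id t).sub ((hasDerivAt_pow 3 t).div_const 6)).congr_deriv ?_
  norm_num
  ring

lemma Real.cos_le_quartic (hx : 0 ≤ x) : Real.cos x ≤ 1 - x ^ 2 / 2 + x ^ 4 / 24 := by
  refine le_of_hasDerivAt_le (g := fun x => 1 - x ^ 2 / 2 + x ^ 4 / 24)
    (g' := fun x => -(x - x ^ 3 / 6)) Real.hasDerivAt_cos (fun t => ?_) (by simp)
    (fun t ht => neg_le_neg (Real.sin_ge_cubic ht)) hx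
  refine ((((hasDerivAt_pow 2 t).div_const 2).const_sub 1).add
    ((hasDerivAt_pow 4 t).div_const 24)).congr_deriv ?_
  norm_num
  ring

lemma Real.sin_le_quintic (hx : 0 ≤ x) : Real.sin x ≤ x - x ^ 3 / 6 + x ^ 5 / 120 := by
  refine le_of_hasDerivAt_le (g := fun x => x - x ^ 3 / 6 + x ^ 5 / 120)
    (g' := fun x => 1 - x ^ 2 / 2 + x ^ 4 / 24) Real.hasDerivAt_sin (fun t => ?_) (by simp)
    (fun t ht => Real.cos_le_quartic ht) hx
  refine (((hasDerivAt_id t).sub ((hasDerivAt_pow 3 t).div_const 6)).add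
    ((hasDerivAt_pow 5 t).div_const 120)).congr_deriv ?_
  norm_num
  ring

lemma Real.cos_ge_sextic (hx : 0 ≤ x) :
    1 - x ^ 2 / 2 + x ^ 4 / 24 - x ^ 6 / 720 ≤ Real.cos x := by
  refine le_of_hasDerivAt_le (f := fun x => 1 - x ^ 2 / 2 + x ^ 4 / 24 - x ^ 6 / 720)
    (f' := fun x => -(x - x ^ 3 / 6 + x ^ 5 / 120)) (fun t => ?_) Real.hasDerivAt_cos (by simp)
    (fun t ht => neg_le_neg (Real.sin_le_quintic ht)) hx
  refine (((((hasDerivAt_pow 2 t).div_const 2).const_sub 1).add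
    ((hasDerivAt_pow 4 t).div_const 24)).sub ((hasDerivAt_pow 6 t).div_const 720)).congr_deriv ?_
  norm_num
  ring

lemma Real.sin_ge_septic (hx : 0 ≤ x) :
    x - x ^ 3 / 6 + x ^ 5 / 120 - x ^ 7 / 5040 ≤ Real.sin x := by
  refine le_of_hasDerivAt_le (f := fun x => x - x ^ 3 / 6 + x ^ 5 / 120 - x ^ 7 / 5040)
    (f' := fun x => 1 - x ^ 2 / 2 + x ^ 4 / 24 - x ^ 6 / 720) (fun t => ?_) Real.hasDerivAt_sin
    (by simp) (fun t ht => Real.cos_ge_sextic ht) hx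
  refine ((((hasDerivAt_id t).sub ((hasDerivAt_pow 3 t).div_const 6)).add
    ((hasDerivAt_pow 5 t).div_const 120)).sub
    ((hasDerivAt_pow 7 t).div_const 5040)).congr_deriv ?_
  norm_num
  ring

lemma Real.cos_le_octic (hx : 0 ≤ x) :
    Real.cos x ≤ 1 - x ^ 2 / 2 + x ^ 4 / 24 - x ^ 6 / 720 + x ^ 8 / 40320 := by
  refine le_of_hasDerivAt_le
    (g := fun x => 1 - x ^ 2 / 2 + x ^ 4 / 24 - x ^ 6 / 720 + x ^ 8 / 40320)
    (g' := fun x => -(x - x ^ 3 / 6 + x ^ 5 / 120 - x ^ 7 / 5040)) Real.hasDerivAt_cos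
    (fun t => ?_) (by simp) (fun t ht => neg_le_neg (Real.sin_ge_septic ht)) hx
  refine ((((((hasDerivAt_pow 2 t).div_const 2).const_sub 1).add
    ((hasDerivAt_pow 4 t).div_const 24)).sub ((hasDerivAt_pow 6 t).div_const 720)).add
    ((hasDerivAt_pow 8 t).div_const 40320)).congr_deriv ?_
  norm_num
  ring

end TaylorBounds

/-- Beyond π/2 this is sin u ≤ u at u = |w| − π/2; it is crude but suffices away from the critical
times. -/
lemma Real.pi_div_two_sub_le_cos {w b : ℝ} (hw : |w| ≤ b) (hb : Real.pi / 2 ≤ b) :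
    Real.pi / 2 - b ≤ Real.cos w := by
  rw [← Real.cos_abs]
  rcases le_total |w| (Real.pi / 2) with h | h
  · have := Real.cos_nonneg_of_mem_Icc (x := |w|) ⟨by linarith [abs_nonneg w, Real.pi_pos], h⟩
    linarith
  · have h1 : Real.sin (|w| - Real.pi / 2) = -Real.cos |w| := Real.sin_sub_pi_div_two _
    have h2 := Real.sin_le (x := |w| - Real.pi / 2) (by linarith)
    linarith

lemma Real.cos_le_of_le {x a : ℝ} (ha : 0 ≤ a) (hax : a ≤ x) (hx : x ≤ 3) :
    Real.cos x ≤ 1 - a ^ 2 / 2 + a ^ 4 / 24 - a ^ 6 / 720 + a ^ 8 / 40320 :=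
  (Real.cos_le_cos_of_nonneg_of_le_pi ha (by linarith [Real.pi_gt_three]) hax).trans
    (Real.cos_le_octic ha)

lemma Real.le_cos_of_le {x b : ℝ} (hx : 0 ≤ x) (hxb : x ≤ b) (hb : b ≤ 3) :
    1 - b ^ 2 / 2 + b ^ 4 / 24 - b ^ 6 / 720 ≤ Real.cos x :=
  (Real.cos_ge_sextic (hx.trans hxb)).trans
    (Real.cos_le_cos_of_nonneg_of_le_pi hx (by linarith [Real.pi_gt_three]) hxb)

lemma Real.sin_le_of_le {x b : ℝ} (hx : 0 ≤ x) (hxb : x ≤ b) (hb : b ≤ 1) :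
    Real.sin x ≤ b - b ^ 3 / 6 + b ^ 5 / 120 :=
  (Real.sin_le_sin_of_le_of_le_pi_div_two (by linarith [Real.pi_gt_three])
    (by linarith [Real.pi_gt_three]) hxb).trans (Real.sin_le_quintic (hx.trans hxb))

lemma Real.le_sin_of_le {x a : ℝ} (ha : 0 ≤ a) (hax : a ≤ x) (hx : x ≤ 1) :
    a - a ^ 3 / 6 + a ^ 5 / 120 - a ^ 7 / 5040 ≤ Real.sin x :=
  (Real.sin_ge_septic ha).trans (Real.sin_le_sin_of_le_of_le_pi_div_two
    (by linarith [Real.pi_gt_three]) (by linarith [Real.pi_gt_three]) hax)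

lemma Real.cos_eq_neg_cos_three_pi_sub (x : ℝ) : Real.cos x = -Real.cos (3 * Real.pi - x) := by
  rw [show 3 * Real.pi - x = Real.pi - x + (1 : ℕ) * (2 * Real.pi) by push_cast; ring,
    Real.cos_add_nat_mul_two_pi, Real.cos_pi_sub, neg_neg]

lemma Real.sin_eq_sin_three_pi_sub (x : ℝ) : Real.sin x = Real.sin (3 * Real.pi - x) := by
  rw [show 3 * Real.pi - x = Real.pi - x + (1 : ℕ) * (2 * Real.pi) by push_cast; ring,
    Real.sin_add_nat_mul_two_pi, Real.sin_pi_sub]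

lemma Real.cos_eq_neg_cos_seven_pi_sub (x : ℝ) : Real.cos x = -Real.cos (7 * Real.pi - x) := by
  rw [show 7 * Real.pi - x = Real.pi - x + (3 : ℕ) * (2 * Real.pi) by push_cast; ring,
    Real.cos_add_nat_mul_two_pi, Real.cos_pi_sub, neg_neg]

lemma Real.sin_eq_sin_seven_pi_sub (x : ℝ) : Real.sin x = Real.sin (7 * Real.pi - x) := by
  rw [show 7 * Real.pi - x = Real.pi - x + (3 : ℕ) * (2 * Real.pi) by push_cast; ring,
    Real.sin_add_nat_mul_two_pi, Real.sin_pi_sub]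

lemma Real.cos_eq_neg_sin_three_pi_div_two_sub (x : ℝ) :
    Real.cos x = -Real.sin (3 * Real.pi / 2 - x) := by
  rw [show 3 * Real.pi / 2 - x = Real.pi / 2 - x + Real.pi by ring, Real.sin_add_pi,
    Real.sin_pi_div_two_sub, neg_neg]

lemma Real.sin_eq_neg_cos_three_pi_div_two_sub (x : ℝ) :
    Real.sin x = -Real.cos (3 * Real.pi / 2 - x) := by
  rw [show 3 * Real.pi / 2 - x = Real.pi / 2 - x + Real.pi by ring, Real.cos_add_pi,
    Real.cos_pi_div_two_sub, neg_neg]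

/-! ### Locating the two times -/

lemma overlap_pos_at : 0 < overlap 9.6925 := by
  have h1 := Real.pi_gt_d6
  have h2 := Real.pi_lt_d6
  rw [overlap, Real.cos_eq_neg_cos_seven_pi_sub (11 * _ / 5), Real.cos_eq_neg_cos_three_pi_sub]
  rw [← Real.cos_abs (3 * Real.pi - _), abs_sub_comm, abs_of_pos (by norm_num; linarith)]
  have e1 := Real.cos_le_of_le (x := 9.6925 - 3 * Real.pi) (a := 0.26772) (by norm_num)
    (by linarith) (by linarith)
  have e2 := Real.cos_le_of_le (x := 7 * Real.pi - 11 * 9.6925 / 5) (a := 0.66764) (by norm_num)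
    (by linarith) (by linarith)
  norm_num at e1 e2 ⊢
  linarith

lemma overlap_neg_at : overlap 9.6935 < 0 := by
  have h1 := Real.pi_gt_d6
  have h2 := Real.pi_lt_d6
  rw [overlap, Real.cos_eq_neg_cos_seven_pi_sub (11 * _ / 5), Real.cos_eq_neg_cos_three_pi_sub]
  rw [← Real.cos_abs (3 * Real.pi - _), abs_sub_comm, abs_of_pos (by norm_num; linarith)]
  have e1 := Real.le_cos_of_le (x := 9.6935 - 3 * Real.pi) (b := 0.26873) (by linarith)
    (by linarith) (by linarith)
  have e2 := Real.le_cos_of_le (x := 7 * Real.pi - 11 * 9.6935 / 5) (b := 0.66546) (by linarith)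
    (by linarith) (by linarith)
  norm_num at e1 e2 ⊢
  linarith

lemma overlapDeriv_neg_at : overlapDeriv 4.1095 < 0 ∧ -0.1 < overlapDeriv 4.1095 := by
  have h1 := Real.pi_gt_d6
  have h2 := Real.pi_lt_d6
  rw [overlapDeriv, Real.sin_eq_sin_three_pi_sub (11 * _ / 5),
    Real.sin_eq_neg_cos_three_pi_div_two_sub 4.1095]
  have e1 := Real.cos_le_of_le (x := 3 * Real.pi / 2 - 4.1095) (a := 0.602885) (by norm_num)
    (by linarith) (by linarith)
  have e2 := Real.le_sin_of_le (x := 3 * Real.pi - 11 * 4.1095 / 5) (a := 0.383875) (by norm_num)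
    (by linarith) (by linarith)
  have e3 := Real.le_cos_of_le (x := 3 * Real.pi / 2 - 4.1095) (b := 0.6029) (by linarith)
    (by linarith) (by linarith)
  have e4 := Real.sin_le_of_le (x := 3 * Real.pi - 11 * 4.1095 / 5) (b := 0.3839) (by linarith)
    (by linarith) (by linarith)
  norm_num at e1 e2 e3 e4 ⊢
  constructor <;> linarith

lemma overlapDeriv_pos_at : 0 < overlapDeriv 4.1105 := by
  have h1 := Real.pi_gt_d6
  have h2 := Real.pi_lt_d6
  rw [overlapDeriv, Real.sin_eq_sin_three_pi_sub (11 * _ / 5),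
    Real.sin_eq_neg_cos_three_pi_div_two_sub 4.1105]
  have e1 := Real.le_cos_of_le (x := 3 * Real.pi / 2 - 4.1105) (b := 0.60189) (by linarith)
    (by linarith) (by linarith)
  have e2 := Real.sin_le_of_le (x := 3 * Real.pi - 11 * 4.1105 / 5) (b := 0.38168) (by linarith)
    (by linarith) (by linarith)
  norm_num at e1 e2 ⊢
  linarith

lemma overlap_at_bounds : 1.0227 ≤ overlap 4.1095 ∧ overlap 4.1095 ≤ 1.0233 := by
  have h1 := Real.pi_gt_d6
  have h2 := Real.pi_lt_d6
  rw [overlap, Real.cos_eq_neg_cos_three_pi_sub (11 * _ / 5),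
    Real.cos_eq_neg_sin_three_pi_div_two_sub 4.1095]
  have e1 := Real.le_sin_of_le (x := 3 * Real.pi / 2 - 4.1095) (a := 0.602885) (by norm_num)
    (by linarith) (by linarith)
  have e2 := Real.le_cos_of_le (x := 3 * Real.pi - 11 * 4.1095 / 5) (b := 0.38388) (by linarith)
    (by linarith) (by linarith)
  have e3 := Real.sin_le_of_le (x := 3 * Real.pi / 2 - 4.1095) (b := 0.60289) (by linarith)
    (by linarith) (by linarith)
  have e4 := Real.cos_le_of_le (x := 3 * Real.pi - 11 * 4.1095 / 5) (a := 0.383875) (by norm_num)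
    (by linarith) (by linarith)
  norm_num at e1 e2 e3 e4 ⊢
  constructor <;> linarith

/-- Both cosines in the second derivative are negative on this interval, so `overlap` is strictly
convex there. -/
lemma strictMonoOn_overlapDeriv : StrictMonoOn overlapDeriv (Set.Icc 3.6 4.7) := by
  refine strictMonoOn_of_hasDerivWithinAt_pos (convex_Icc _ _) continuous_overlapDeriv.continuousOn
    (fun t _ => (hasDerivAt_overlapDeriv t).hasDerivWithinAt) fun t ht => ?_
  rw [interior_Icc] at ht
  have h1 := Real.pi_gt_d6
  have h2 := Real.pi_lt_d6
  have c1 : Real.cos t < 0 :=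
    Real.cos_neg_of_pi_div_two_lt_of_lt (by linarith [ht.1]) (by linarith [ht.2])
  have c2 : Real.cos (11 * t / 5) < 0 := by
    rw [← Real.cos_sub_two_pi]
    exact Real.cos_neg_of_pi_div_two_lt_of_lt (by linarith [ht.1]) (by linarith [ht.2])
  linarith

/-- The local minimum of `overlap` close to `4.11`. -/
lemma exists_overlap_min : ∃ s, 4.1095 < s ∧ s < 4.1105 ∧ overlapDeriv s = 0 ∧
    (∀ t ∈ Set.Icc (3.6 : ℝ) 4.7, t ≠ s → overlap s < overlap t) ∧
    1.0225 ≤ overlap s ∧ overlap s ≤ 1.0235 := by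
  obtain ⟨s, hs, hs0⟩ := intermediate_value_Ioo (by norm_num : (4.1095 : ℝ) ≤ 4.1105)
    continuous_overlapDeriv.continuousOn ⟨overlapDeriv_neg_at.1, overlapDeriv_pos_at⟩
  have hsI : s ∈ Set.Icc (3.6 : ℝ) 4.7 := ⟨by linarith [hs.1], by linarith [hs.2]⟩
  have hmin : ∀ t ∈ Set.Icc (3.6 : ℝ) 4.7, t ≠ s → overlap s < overlap t := by
    intro t ht hne
    rcases hne.lt_or_gt with h | h
    · have := strictAntiOn_of_hasDerivWithinAt_neg (convex_Icc t s) continuous_overlap.continuousOn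
        (fun x _ => (hasDerivAt_overlap x).hasDerivWithinAt) (fun x hx => by
          rw [interior_Icc] at hx
          rw [← hs0]
          exact strictMonoOn_overlapDeriv ⟨ht.1.trans hx.1.le, hx.2.le.trans hsI.2⟩ hsI hx.2)
      exact this ⟨le_rfl, h.le⟩ ⟨h.le, le_rfl⟩ h
    · have := strictMonoOn_of_hasDerivWithinAt_pos (convex_Icc s t) continuous_overlap.continuousOn
        (fun x _ => (hasDerivAt_overlap x).hasDerivWithinAt) (fun x hx => by
          rw [interior_Icc] at hx
          rw [← hs0]
          exact strictMonoOn_overlapDeriv hsI ⟨hsI.1.trans hx.1.le, hx.2.le.trans ht.2⟩ hx.1)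
      exact this ⟨le_rfl, h.le⟩ ⟨h.le, le_rfl⟩ h
  have hlt := hmin 4.1095 ⟨by norm_num, by norm_num⟩ hs.1.ne
  obtain ⟨ξ, hξ, hξs⟩ := exists_hasDerivAt_eq_slope overlap overlapDeriv hs.1
    continuous_overlap.continuousOn (fun x _ => hasDerivAt_overlap x)
  have hξ' := strictMonoOn_overlapDeriv (a := 4.1095) (b := ξ) ⟨by norm_num, by norm_num⟩
    ⟨by linarith [hξ.1], by linarith [hξ.2, hs.2]⟩ hξ.1
  have h1 := overlapDeriv_neg_at.2
  have h2 := overlap_at_bounds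
  rw [eq_div_iff (by linarith [hs.1])] at hξs
  -- Between 4.1095 and s the slope exceeds −0.1, so the overlap drops by at most 0.0001 from its
  -- value at 4.1095.
  have h3 : -0.1 * (s - 4.1095) ≤ overlapDeriv ξ * (s - 4.1095) :=
    mul_le_mul_of_nonneg_right (by linarith) (by linarith [hs.1])
  refine ⟨s, hs.1, hs.2, hs0, hmin, ?_, ?_⟩
  · linarith [hs.2, h2.1]
  · linarith [h2.2]

/-- On each half one cosine exceeds −0.475 while the other is at least −1. The bound 1.1 lies above
the local minimum value near 4.11, which is what makes τ_c2 a first time. -/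
lemma overlap_gt_of_le {t : ℝ} (h0 : 0 ≤ t) (ht : t ≤ 3.6) : 1.1 < overlap t := by
  have h1 := Real.pi_gt_d6
  have h2 := Real.pi_lt_d6
  rw [overlap]
  rcases le_total t 2 with h | h
  · have e1 := Real.pi_div_two_sub_le_cos (w := t) (b := 2) (abs_le.2 ⟨by linarith, h⟩)
      (by linarith)
    have e2 := Real.neg_one_le_cos (11 * t / 5)
    linarith
  · have e1 := Real.pi_div_two_sub_le_cos (w := 11 * t / 5 - 2 * Real.pi) (b := 1.9)
      (abs_le.2 ⟨by linarith, by linarith⟩) (by linarith)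
    rw [Real.cos_sub_two_pi] at e1
    have e2 := Real.neg_one_le_cos t
    linarith

/-- Away from the two delicate zones one cosine exceeds −3/4, which suffices. Near 4.11 the local
minimum is positive, and on the last stretch the overlap decreases to its positive value at 9.6925.
-/
lemma overlap_pos_of_le {t : ℝ} (h0 : 0 ≤ t) (ht : t ≤ 9.6925) : 0 < overlap t := by
  have h1 := Real.pi_gt_d6
  have h2 := Real.pi_lt_d6
  rcases le_total t 3.6 with h | h
  · linarith [overlap_gt_of_le h0 h]
  rcases le_total t 4.7 with h' | h'
  · obtain ⟨s, -, -, -, hmin, hs, -⟩ := exists_overlap_min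
    rcases eq_or_ne t s with rfl | hne
    · linarith
    · linarith [hmin t ⟨h, h'⟩ hne]
  rcases le_total t 7.86 with h'' | h''
  · have e1 := Real.pi_div_two_sub_le_cos (w := t - 2 * Real.pi) (b := 1.6)
      (abs_le.2 ⟨by linarith, by linarith⟩) (by linarith)
    rw [Real.cos_sub_two_pi] at e1
    have e2 := Real.neg_one_le_cos (11 * t / 5)
    rw [overlap]
    linarith
  rcases le_total t 9.6 with h9 | h9
  · have e1 := Real.pi_div_two_sub_le_cos (w := 11 * t / 5 - (3 : ℕ) * (2 * Real.pi)) (b := 2.3)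
      (by push_cast; exact abs_le.2 ⟨by linarith, by linarith⟩) (by linarith)
    rw [Real.cos_sub_nat_mul_two_pi] at e1
    have e2 := Real.neg_one_le_cos t
    rw [overlap]
    linarith
  · have hanti : AntitoneOn overlap (Set.Icc 9.6 9.6925) :=
      antitoneOn_of_hasDerivWithinAt_nonpos (convex_Icc _ _) continuous_overlap.continuousOn
        (fun x _ => (hasDerivAt_overlap x).hasDerivWithinAt) fun x hx => by
          rw [interior_Icc] at hx
          obtain ⟨hx1, hx2⟩ := hx
          rw [overlapDeriv, Real.sin_eq_sin_seven_pi_sub (11 * x / 5),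
            Real.sin_eq_sin_three_pi_sub x, ← neg_sub x, Real.sin_neg]
          have e1 := Real.sin_le (x := x - 3 * Real.pi) (by linarith)
          have e2 := Real.le_sin_of_le (x := 7 * Real.pi - 11 * x / 5) (a := 0.66)
            (by norm_num) (by linarith) (by linarith)
          norm_num at e2
          linarith
    exact overlap_pos_at.trans_le (hanti ⟨h9, ht⟩ ⟨by norm_num, le_rfl⟩ ht)

lemma continuous_rootFidelity : Continuous rootFidelity := by
  rw [show rootFidelity = _ from funext rootFidelity_eq]
  exact continuous_overlap.abs.div_const 15

lemma rootFidelity_eq_zero_iff (τ : ℝ) : rootFidelity τ = 0 ↔ overlap τ = 0 := by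
  rw [rootFidelity_eq]
  simp

lemma IsTauC1.bounds {τ : ℝ} (h : IsTauC1 τ) : 9.6925 < τ ∧ τ ≤ 9.6935 := by
  obtain ⟨z, hz, hz0⟩ := intermediate_value_Icc' (by norm_num : (9.6925 : ℝ) ≤ 9.6935)
    continuous_overlap.continuousOn ⟨overlap_neg_at.le, overlap_pos_at.le⟩
  constructor
  · by_contra! hle
    exact (overlap_pos_of_le h.1.1 hle).ne' ((rootFidelity_eq_zero_iff τ).1 h.1.2)
  · exact (h.2 ⟨by linarith [hz.1], (rootFidelity_eq_zero_iff z).2 hz0⟩).trans hz.2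

lemma existsUnique_isTauC1 : ∃! τ, IsTauC1 τ := by
  obtain ⟨z, hz, hz0⟩ := intermediate_value_Icc' (by norm_num : (9.6925 : ℝ) ≤ 9.6935)
    continuous_overlap.continuousOn ⟨overlap_neg_at.le, overlap_pos_at.le⟩
  have hclosed : IsClosed {t : ℝ | 0 ≤ t ∧ rootFidelity t = 0} :=
    (isClosed_le continuous_const continuous_id).inter
      (isClosed_eq continuous_rootFidelity continuous_const)
  have hleast := hclosed.isLeast_csInf
    ⟨z, by linarith [hz.1], (rootFidelity_eq_zero_iff z).2 hz0⟩ ⟨0, fun t ht => ht.1⟩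
  exact ⟨_, hleast, fun t ht => IsLeast.unique ht hleast⟩

/-- The time `τ_c2` is the critical point of `overlap` near `4.11`. -/
lemma exists_isTauC2_iff : ∃ s, (∀ τ, IsTauC2 τ ↔ τ = s) ∧ 4.1095 < s ∧ s < 4.1105 ∧
    |rootFidelity s - 0.0682| ≤ 0.00005 := by
  obtain ⟨s, hs1, hs2, hs0, hmin, hlo, hhi⟩ := exists_overlap_min
  have hle : ∀ t, 0 ≤ t → t < s → overlap s < overlap t := fun t h0 ht => by
    rcases le_total t 3.6 with h | h
    · linarith [overlap_gt_of_le h0 h]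
    · exact hmin t ⟨h, by linarith⟩ ht.ne
  have hpos : ∀ t ∈ Set.Icc (3.6 : ℝ) 4.7, 0 < overlap t := fun t ht =>
    overlap_pos_of_le (by linarith [ht.1]) (by linarith [ht.2])
  have hrf : ∀ t ∈ Set.Icc (3.6 : ℝ) 4.7, rootFidelity t = overlap t / 15 := fun t ht => by
    rw [rootFidelity_eq, abs_of_pos (hpos t ht)]
  have hsI : s ∈ Set.Icc (3.6 : ℝ) 4.7 := ⟨by linarith, by linarith⟩
  refine ⟨s, fun τ => ⟨fun ⟨hτ, hloc, _⟩ => ?_, ?_⟩, hs1, hs2, ?_⟩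
  · rw [abs_le] at hτ
    have hτI : τ ∈ Set.Icc (3.6 : ℝ) 4.7 := ⟨by linarith, by linarith⟩
    have hnhds : Set.Icc (3.6 : ℝ) 4.7 ∈ nhds τ := Icc_mem_nhds (by linarith) (by linarith)
    -- Positivity of the overlap here lets the absolute value be dropped; τ is then a critical
    -- point, and the derivative is injective on [3.6, 4.7].
    have hloc' : IsLocalMin overlap τ := by
      filter_upwards [hloc, hnhds] with t ht htI
      rw [hrf t htI, hrf τ hτI] at ht
      linarith
    have := hloc'.hasDerivAt_eq_zero (hasDerivAt_overlap τ)
    exact strictMonoOn_overlapDeriv.injOn hτI hsI (this.trans hs0.symm)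
  · rintro rfl
    refine ⟨abs_le.2 ⟨by linarith, by linarith⟩, ?_, ⟨⟨by linarith, rfl⟩, fun t ht => ?_⟩⟩
    · filter_upwards [Icc_mem_nhds (by linarith : (3.6 : ℝ) < τ) (by linarith : τ < 4.7)] with t ht
      rw [hrf t ht, hrf τ hsI]
      rcases eq_or_ne t τ with rfl | hne
      · exact le_rfl
      · linarith [hmin t ht hne]
    · by_contra! hlt
      have h1 := hle t ht.1 hlt
      have h2 := ht.2
      rw [hrf τ hsI, rootFidelity_eq, abs_of_pos (by linarith)] at h2
      linarith
  · rw [hrf s hsI]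
    exact abs_le.2 ⟨by linarith, by linarith⟩

/-! ### The concrete nodes and the return to the variable x -/

lemma nodalPolynomial_nodeMultiset_eval_pos {l : List (ℝ × ℕ)} {y : ℝ}
    (hl : ∀ p ∈ l, Even p.2 ∧ y ≠ p.1) : 0 < (nodalPolynomial (nodeMultiset l)).eval y := by
  induction l with
  | nil => simp [nodalPolynomial, nodeMultiset]
  | cons p l ih =>
    rw [nodeMultiset_cons, nodalPolynomial, Multiset.map_add, Multiset.prod_add,
      Multiset.map_replicate, Multiset.prod_replicate, eval_mul, eval_pow, eval_sub, eval_X, eval_C]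
    have hp := hl p (by simp)
    exact mul_pos (hp.1.pow_pos (sub_ne_zero.2 hp.2)) (ih fun q hq => hl q (by simp [hq]))

/-- The interpolation nodes with their multiplicities. -/
noncomputable def hermiteNodes (τ₁ τ₂ : ℝ) : List (ℝ × ℕ) :=
  [(0, 3), (τ₁, 4), (-τ₁, 4), (τ₂, 2), (-τ₂, 2), (11 * τ₁ / 5, 6), (-(11 * τ₁ / 5), 6),
    (11 * τ₂ / 5, 4), (-(11 * τ₂ / 5), 4)]

/-- The squares of the interpolation nodes with their multiplicities. -/
noncomputable def hermiteSqNodes (τ₁ τ₂ : ℝ) : List (ℝ × ℕ) :=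
  [(0, 2), (τ₁ ^ 2, 4), (τ₂ ^ 2, 2), ((11 * τ₁ / 5) ^ 2, 6), ((11 * τ₂ / 5) ^ 2, 4)]

lemma isHermitePe_iff {τ₁ τ₂ : ℝ} {p : ℝ[X]} : IsHermitePe τ₁ τ₂ p ↔
    p.natDegree ≤ 34 ∧ ∀ q ∈ hermiteNodes τ₁ τ₂, AgreesToOrder Real.cos p q.1 q.2 := by
  simp [IsHermitePe, hermiteNodes, and_assoc]

lemma card_hermiteNodes (τ₁ τ₂ : ℝ) : (nodeMultiset (hermiteNodes τ₁ τ₂)).card = 35 := by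
  simp [nodeMultiset, hermiteNodes]

lemma card_hermiteSqNodes (τ₁ τ₂ : ℝ) : (nodeMultiset (hermiteSqNodes τ₁ τ₂)).card = 18 := by
  simp [nodeMultiset, hermiteSqNodes]

lemma IsHermitePe.unique {τ₁ τ₂ : ℝ} (hl : ((hermiteNodes τ₁ τ₂).map Prod.fst).Nodup)
    {p q : ℝ[X]} (hp : IsHermitePe τ₁ τ₂ p) (hq : IsHermitePe τ₁ τ₂ q) : p = q := by
  rw [isHermitePe_iff] at hp hq
  refine sub_eq_zero.1 (eq_zero_of_iterate_derivative_eval_eq_zero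
    (M := nodeMultiset (hermiteNodes τ₁ τ₂)) ?_ ?_)
  · rw [card_hermiteNodes]
    have := natDegree_sub_le p q
    omega
  · refine (forall_nodeMultiset_iff hl (Q := fun j a => (derivative^[j] (p - q)).eval a = 0)).2
      fun r hr j hj => ?_
    rw [iterate_derivative_sub, eval_sub, hp.2 r hr j hj, hq.2 r hr j hj, sub_self]

lemma agreesToOrder_of_iteratedDeriv_sub {p : ℝ[X]} {x : ℝ} {m : ℕ}
    (h : ∀ j < m, iteratedDeriv j (fun t => Real.cos t - p.eval t) x = 0) :
    AgreesToOrder Real.cos p x m := fun j hj => by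
  have hp : ContDiff ℝ j fun t => p.eval t :=
    contDiff_of_hasDerivAt_family (hasDerivAt_eval_iterate_derivative p) j 0
  have h0 := h j hj
  rw [iteratedDeriv_fun_sub Real.contDiff_cos.contDiffAt hp.contDiffAt,
    iteratedDeriv_polynomial_eval] at h0
  linarith

lemma hermiteError_zero_sq (M : Multiset ℝ) (P : ℝ[X]) (t : ℝ) :
    hermiteError M P 0 0 (t ^ 2) = Real.cos t - (expand ℝ 2 P).eval t := by
  simp [hermiteError, cosSqrt_zero_sq, expand_eval]

lemma agreesToOrder_expand {M : Multiset ℝ} {P : ℝ[X]} {x y : ℝ} {m : ℕ} (hy : x ^ 2 = y)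
    (h : ∀ i < m, hermiteError M P 0 i y = 0) : AgreesToOrder Real.cos (expand ℝ 2 P) x m := by
  subst hy
  refine agreesToOrder_of_iteratedDeriv_sub fun j hj => ?_
  have := iteratedDeriv_comp_sq_eq_zero (hasDerivAt_hermiteError M P 0) h j 0 1 (by omega)
  simpa only [eval_one, one_mul, hermiteError_zero_sq] using this

/-- The error E(t²) is even, with second derivative 2E'(0) at 0. A double node at y = 0 thus
accounts for the triple node at x = 0, whereas the other multiplicities are unchanged. -/
lemma agreesToOrder_expand_zero {M : Multiset ℝ} {P : ℝ[X]}
    (h : ∀ i < 2, hermiteError M P 0 i 0 = 0) :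
    AgreesToOrder Real.cos (expand ℝ 2 P) 0 3 := by
  refine agreesToOrder_of_iteratedDeriv_sub fun j hj => ?_
  simp only [← hermiteError_zero_sq M]
  rcases Nat.lt_succ_iff_lt_or_eq.1 hj with hj | rfl
  · have := iteratedDeriv_comp_sq_eq_zero (hasDerivAt_hermiteError M P 0) (x := 0)
      (m := 2) (by rw [zero_pow two_ne_zero]; exact h) j 0 1 (by omega)
    simpa only [eval_one, one_mul] using this
  · exact iteratedDeriv_two_comp_sq_zero (hasDerivAt_hermiteError M P 0) (h 1 (by omega))

lemma nodup_hermiteNodes {τ₁ τ₂ : ℝ} (h2 : 0 < τ₂) (h21 : 11 * τ₂ / 5 < τ₁) :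
    ((hermiteNodes τ₁ τ₂).map Prod.fst).Nodup := by
  simp only [hermiteNodes, List.map_cons, List.map_nil, List.nodup_cons, List.mem_cons,
    List.not_mem_nil, or_false, not_or, not_false_eq_true, List.nodup_nil, and_true]
  refine ⟨⟨?_, ?_, ?_, ?_, ?_, ?_, ?_, ?_⟩, ⟨?_, ?_, ?_, ?_, ?_, ?_, ?_⟩, ⟨?_, ?_, ?_, ?_, ?_, ?_⟩,
    ⟨?_, ?_, ?_, ?_, ?_⟩, ⟨?_, ?_, ?_, ?_⟩, ⟨?_, ?_, ?_⟩, ⟨?_, ?_⟩, ?_⟩ <;>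
  · intro h
    linarith

lemma nodup_hermiteSqNodes {τ₁ τ₂ : ℝ} (h2 : 0 < τ₂) (h21 : 11 * τ₂ / 5 < τ₁) :
    ((hermiteSqNodes τ₁ τ₂).map Prod.fst).Nodup := by
  have e : ∀ a b : ℝ, 0 ≤ a → a < b → a ^ 2 < b ^ 2 := fun a b ha hab =>
    pow_lt_pow_left₀ hab ha two_ne_zero
  have h1 := e 0 τ₂ le_rfl h2
  have h3 := e τ₂ (11 * τ₂ / 5) h2.le (by linarith)
  have h4 := e (11 * τ₂ / 5) τ₁ (by linarith) h21
  have h5 := e τ₁ (11 * τ₁ / 5) (by linarith) (by linarith)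
  simp only [hermiteSqNodes, List.map_cons, List.map_nil, List.nodup_cons, List.mem_cons,
    List.not_mem_nil, or_false, not_or, not_false_eq_true, List.nodup_nil, and_true]
  refine ⟨⟨?_, ?_, ?_, ?_⟩, ⟨?_, ?_, ?_⟩, ⟨?_, ?_⟩, ?_⟩ <;>
  · intro h
    linarith

/-- There is an even polynomial `P (x ^ 2)` satisfying the interpolation conditions. -/
lemma exists_isHermitePe_expand {τ₁ τ₂ : ℝ} (h2 : 0 < τ₂) (h21 : 11 * τ₂ / 5 < τ₁)
    (h2' : τ₂ ≤ 4.2) (h1' : τ₁ ≤ 9.6935) :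
    ∃ P : ℝ[X], IsCosSqrtInterpolant (nodeMultiset (hermiteSqNodes τ₁ τ₂)) P ∧
      IsHermitePe τ₁ τ₂ (expand ℝ 2 P) := by
  have hnd := nodup_hermiteSqNodes h2 h21
  obtain ⟨P, hdeg, hP⟩ := exists_hermite_interpolant (M := nodeMultiset (hermiteSqNodes τ₁ τ₂))
    (by rw [card_hermiteSqNodes]; norm_num) fun j a => (-1) ^ j * cosSqrt j a
  rw [card_hermiteSqNodes] at hdeg
  -- These two bounds fit the constants of `IsCosSqrtInterpolant`: (11/5)² · 94 = 454.96 for the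
  -- largest node, and 33.04 · 94 + 21.36 · 18 < 4050 for the sum.
  have s1 : τ₁ ^ 2 ≤ 94 := by nlinarith
  have s2 : τ₂ ^ 2 ≤ 18 := by nlinarith
  have hI : IsCosSqrtInterpolant (nodeMultiset (hermiteSqNodes τ₁ τ₂)) P := by
    refine ⟨card_hermiteSqNodes τ₁ τ₂, fun a ha => ?_, ?_, hdeg, hP⟩
    · obtain ⟨q, hq, rfl⟩ := exists_of_mem_nodeMultiset ha
      simp only [hermiteSqNodes, List.mem_cons, List.not_mem_nil, or_false] at hq
      rcases hq with rfl | rfl | rfl | rfl | rfl <;>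
        exact ⟨by positivity, by nlinarith⟩
    · simp only [nodeMultiset, hermiteSqNodes, List.map_cons, List.map_nil, List.sum_cons,
        List.sum_nil, Multiset.sum_add, Multiset.sum_replicate, Multiset.sum_zero, nsmul_eq_mul]
      push_cast
      nlinarith
  refine ⟨P, hI, isHermitePe_iff.2 ⟨by rw [natDegree_expand]; omega, ?_⟩⟩
  have hE := (forall_nodeMultiset_iff hnd (Q := fun j a => hermiteError
    (nodeMultiset (hermiteSqNodes τ₁ τ₂)) P 0 j a = 0)).1 (hI.hermiteError_eq_zero 0)
  generalize nodeMultiset (hermiteSqNodes τ₁ τ₂) = M at hE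
  simp only [hermiteSqNodes, List.forall_mem_cons, List.not_mem_nil, IsEmpty.forall_iff,
    implies_true, and_true] at hE
  obtain ⟨e0, e1, e2, e3, e4⟩ := hE
  simp only [hermiteNodes, List.forall_mem_cons, List.not_mem_nil, IsEmpty.forall_iff,
    implies_true, and_true]
  exact ⟨agreesToOrder_expand_zero e0, agreesToOrder_expand rfl e1,
    agreesToOrder_expand (neg_sq _) e1, agreesToOrder_expand rfl e2,
    agreesToOrder_expand (neg_sq _) e2, agreesToOrder_expand rfl e3,
    agreesToOrder_expand (neg_sq _) e3, agreesToOrder_expand rfl e4,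
    agreesToOrder_expand (neg_sq _) e4⟩

lemma sq_mem_nodes_iff {τ₁ τ₂ x : ℝ} :
    (∃ q ∈ hermiteSqNodes τ₁ τ₂, q.1 = x ^ 2) ↔ x ∈ nodeSet τ₁ τ₂ := by
  simp only [hermiteSqNodes, List.exists_mem_cons_iff, List.not_mem_nil, false_and, exists_false,
    or_false, nodeSet, Set.mem_insert_iff, Set.mem_singleton_iff, sq_eq_sq_iff_eq_or_eq_neg,
    @eq_comm ℝ _ (x ^ 2)]
  simp only [sq_eq_zero_iff, or_assoc]

theorem mainTheorem3 :
    (∃! τ₁ : ℝ, IsTauC1 τ₁) ∧ (∃! τ₂ : ℝ, IsTauC2 τ₂) ∧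
    ∀ τ₁ τ₂ : ℝ, IsTauC1 τ₁ → IsTauC2 τ₂ →
      |τ₁ - 9.693| ≤ 0.0005 ∧ |rootFidelity τ₂ - 0.0682| ≤ 0.00005 ∧
      (∃! p : Polynomial ℝ, IsHermitePe τ₁ τ₂ p) ∧
      ∀ p : Polynomial ℝ, IsHermitePe τ₁ τ₂ p →
        (∀ x : ℝ, p.eval (-x) = p.eval x) ∧
        p.natDegree = 34 ∧
        (∀ x : ℝ, p.eval x ≤ Real.cos x) ∧
        {x : ℝ | p.eval x = Real.cos x} = nodeSet τ₁ τ₂ := by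
  obtain ⟨s, hs, hs1, hs2, hrf⟩ := exists_isTauC2_iff
  refine ⟨existsUnique_isTauC1, ⟨s, (hs s).2 rfl, fun t ht => (hs t).1 ht⟩, ?_⟩
  intro τ₁ τ₂ h₁ h₂
  obtain rfl := (hs τ₂).1 h₂
  obtain ⟨hb1, hb2⟩ := h₁.bounds
  have h21 : 11 * τ₂ / 5 < τ₁ := by linarith
  obtain ⟨P, hI, hP⟩ := exists_isHermitePe_expand (by linarith) h21 (by linarith) hb2
  have huniq := fun p hp => IsHermitePe.unique (nodup_hermiteNodes (by linarith) h21) (p := p) hp hP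
  refine ⟨abs_le.2 ⟨by linarith, by linarith⟩, hrf, ⟨_, hP, huniq⟩, fun p hp => ?_⟩
  obtain rfl := huniq p hp
  have hnode : ∀ x ∈ nodeSet τ₁ τ₂, (expand ℝ 2 P).eval x = Real.cos x := fun x hx => by
    obtain ⟨q, hq, hqx⟩ := sq_mem_nodes_iff.2 hx
    have hE := (forall_nodeMultiset_iff (nodup_hermiteSqNodes (by linarith) h21)
      (Q := fun j a => hermiteError _ P 0 j a = 0)).1 (hI.hermiteError_eq_zero 0) q hq 0 (by
        simp only [hermiteSqNodes, List.mem_cons, List.not_mem_nil, or_false] at hq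
        rcases hq with rfl | rfl | rfl | rfl | rfl <;> norm_num)
    rw [hqx, hermiteError_zero_sq] at hE
    linarith
  have hlt : ∀ x ∉ nodeSet τ₁ τ₂, (expand ℝ 2 P).eval x < Real.cos x := fun x hx => by
    rw [expand_eval, ← cosSqrt_zero_sq]
    refine hI.eval_lt (sq_nonneg x) (nodalPolynomial_nodeMultiset_eval_pos fun q hq => ⟨?_, ?_⟩)
    · simp only [hermiteSqNodes, List.mem_cons, List.not_mem_nil, or_false] at hq
      rcases hq with rfl | rfl | rfl | rfl | rfl <;> simp [Nat.even_iff]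
    · exact fun he => hx (sq_mem_nodes_iff.1 ⟨q, hq, he.symm⟩)
  refine ⟨fun x => by rw [expand_eval, expand_eval, neg_sq], ?_, fun x => ?_, ?_⟩
  · have h1 := le_natDegree_of_ne_zero hI.coeff_neg.ne
    have h2 := hI.natDegree_lt
    rw [natDegree_expand]
    omega
  · by_cases hx : x ∈ nodeSet τ₁ τ₂
    · exact (hnode x hx).le
    · exact (hlt x hx).le
  · ext x
    refine ⟨fun hx => ?_, hnode x⟩
    by_contra hn
    exact (hlt x hn).ne hx
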